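/- Let $A$ be a unital C*-algebra, $n\ge 1$, and $\sigma$ a *-automorphism of $A$ with $\sigma^n=\mathrm{Id}_A$ ($n$ need not be the smallest such integer). Let $A\rtimes_\sigma\mathbb Z_n$ be the crossed product, i.e. the universal C*-algebra generated by a copy of $A$ and a unitary $U$ with $U^n=1$ and $UaU^*=\sigma(a)$ for $a\in A$, and let $A_1=\{a\in A:\sigma(a)=a\}$. Representations are unital *-representations on complex Hilbert spaces; irreducible representations act on nonzero spaces; equivalence means unitary equivalence. A representation of $A\rtimes_\sigma\mathbb Z_n$ is called minimal if it is irreducible and its restriction to $A$ is irreducible. For positive integers $k,m$ with $km=n$, call $(\pi_1,V)$ a $(k,m)$-datum if $\pi_1$ is an irreducible representation of $A$ on a Hilbert space $\mathcal J$ and $V$ is a unitary on $\mathcal J$ such that $V^k=1$, $V\pi_1(a)V^*=\pi_1(\sigma^m(a))$ for all $a\in A$, and $\pi_1$ is not equivalent to $\pi_1\circ\sigma^i$ for $0<i<m$. (i) Let $\Pi$ be a representation of $A\rtimes_\sigma\mathbb Z_n$ on a Hilbert space. Then $\Pi$ is irreducible if and only if there are positive integers $k,m$ with $km=n$ and a $(k,m)$-datum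 $(\pi_1,V)$ such that $\Pi$ is unitarily equivalent to a representation $\Pi'$ on $\mathcal J\oplus\cdots\oplus\mathcal J$ ($m$ copies) with $$\Pi'(a)=\pi_1(a)\oplus\pi_1(\sigma(a))\oplus\cdots\oplus\pi_1(\sigma^{m-1}(a))\quad(a\in A),\qquad \Pi'(U)=\begin{pmatrix}0&1&&\\&\ddots&\ddots&\\&&0&1\\V&&&0\end{pmatrix},$$ that is, $\Pi'(U)(\xi_0,\dots,\xi_{m-1})=(\xi_1,\dots,\xi_{m-1},V\xi_0)$ (so $\Pi'(U)=V$ if $m=1$). (ii) Let $km=n$ and let $(\pi_1,V)$ be any $(k,m)$-datum. Then: - there is exactly one representation $\Pi'$ of $A\rtimes_\sigma\mathbb Z_n$ given by the formulas in (i), and it is irreducible; - there is exactly one representation $\psi$ of $A\rtimes_{\sigma^m}\mathbb Z_k$ on $\mathcal J$ with $\psi(a)=\pi_1(a)$ for $a\in A$ and $\psi(U)=V$, where $U$ now denotes the canonical unitary of $A\rtimes_{\sigma^m}\mathbb Z_k$, and $\psi$ is minimal; - the spectrum of $V$ is finite, and if $\eta$ is its cardinality, then there are irreducible, pairwise inequivalent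 representations $\varphi_1,\dots,\varphi_\eta$ of $A_1$ such that for every $i\in\{0,\dots,m-1\}$ the restriction of $\pi_1\circ\sigma^i$ to $A_1$ is unitarily equivalent to $\varphi_1\oplus\cdots\oplus\varphi_\eta$. -/

import Mathlib

universe u v

/-! ### Representations of *-algebras on Hilbert spaces -/

/-- A representation of a unital complex *-algebra `B` on a Hilbert space `H` (a unital
*-homomorphism into the bounded operators) is irreducible when `H` is nonzero and the only closed
subspaces that are invariant under the representation are `0` and `H`. -/
def IsIrreducibleRep {B : Type*} [Ring B] [StarRing B] [Algebra ℂ B]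
    {H : Type*} [NormedAddCommGroup H] [InnerProductSpace ℂ H] [CompleteSpace H]
    (ρ : B →⋆ₐ[ℂ] (H →L[ℂ] H)) : Prop :=
  Nontrivial H ∧ ∀ K : Submodule ℂ H, IsClosed (K : Set H) →
    (∀ b : B, ∀ x ∈ K, ρ b x ∈ K) → K = ⊥ ∨ K = ⊤

/-- Unitary equivalence of representations. -/
def UnitarilyEquivalent {B : Type*} [Ring B] [StarRing B] [Algebra ℂ B]
    {H : Type*} [NormedAddCommGroup H] [InnerProductSpace ℂ H] [CompleteSpace H]
    {H' : Type*} [NormedAddCommGroup H'] [InnerProductSpace ℂ H'] [CompleteSpace H']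
    (ρ : B →⋆ₐ[ℂ] (H →L[ℂ] H)) (ρ' : B →⋆ₐ[ℂ] (H' →L[ℂ] H')) : Prop :=
  ∃ W : H ≃ₗᵢ[ℂ] H', ∀ (b : B) (x : H), W (ρ b x) = ρ' b (W x)

/-- The block-diagonal operator `⊕ⱼ Tⱼ` on the Hilbert space direct sum `⊕ⱼ Kⱼ`. -/
noncomputable def diagonalOperator {ι : Type*} [Fintype ι] {K : ι → Type*}
    [∀ j, NormedAddCommGroup (K j)] [∀ j, InnerProductSpace ℂ (K j)]
    (T : ∀ j, K j →L[ℂ] K j) : PiLp 2 K →L[ℂ] PiLp 2 K :=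
  ((PiLp.continuousLinearEquiv 2 ℂ K).symm : (∀ j, K j) →L[ℂ] PiLp 2 K) ∘L
    ContinuousLinearMap.pi fun j => T j ∘L PiLp.proj 2 K j

@[simp] theorem diagonalOperator_apply {ι : Type*} [Fintype ι] {K : ι → Type*}
    [∀ j, NormedAddCommGroup (K j)] [∀ j, InnerProductSpace ℂ (K j)]
    (T : ∀ j, K j →L[ℂ] K j) (ξ : PiLp 2 K) (j : ι) :
    diagonalOperator T ξ j = T j (ξ j) := rfl

/-- The direct sum `⊕ⱼ ρⱼ` of finitely many representations. -/
noncomputable def directSumRep {B : Type*} [Ring B] [StarRing B] [Algebra ℂ B]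
    {ι : Type*} [Fintype ι] {K : ι → Type*}
    [∀ j, NormedAddCommGroup (K j)] [∀ j, InnerProductSpace ℂ (K j)] [∀ j, CompleteSpace (K j)]
    (ρ : ∀ j, B →⋆ₐ[ℂ] (K j →L[ℂ] K j)) : B →⋆ₐ[ℂ] (PiLp 2 K →L[ℂ] PiLp 2 K) where
  toFun b := diagonalOperator fun j => ρ j b
  map_one' := by ext ξ j; simp
  map_mul' a b := by ext ξ j; simp
  map_zero' := by ext ξ j; simp
  map_add' a b := by ext ξ j; simp
  commutes' c := by
    ext ξ j
    simp only [diagonalOperator_apply, Algebra.algebraMap_eq_smul_one]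
    simp
  map_star' b := by
    rw [ContinuousLinearMap.star_eq_adjoint, ContinuousLinearMap.eq_adjoint_iff]
    intro ξ ζ
    simp only [PiLp.inner_apply, diagonalOperator_apply, map_star,
      ContinuousLinearMap.star_eq_adjoint, ContinuousLinearMap.adjoint_inner_left]

/-- The operator on `J ⊕ ⋯ ⊕ J` (`m` copies) whose matrix has `1` in the entries `(i, i + 1)`, has
`V` in the lower left corner `(m - 1, 0)`, and vanishes elsewhere: it maps `(ξ₀, …, ξ_{m-1})` to
`(ξ₁, …, ξ_{m-1}, V ξ₀)`. -/
noncomputable def cyclicShift {J : Type*} [NormedAddCommGroup J] [InnerProductSpace ℂ J]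
    (m : ℕ) (V : J →L[ℂ] J) :
    PiLp 2 (fun _ : Fin m => J) →L[ℂ] PiLp 2 (fun _ : Fin m => J) :=
  ((PiLp.continuousLinearEquiv 2 ℂ (fun _ : Fin m => J)).symm :
      (Fin m → J) →L[ℂ] PiLp 2 (fun _ : Fin m => J)) ∘L
    ContinuousLinearMap.pi fun i : Fin m =>
      if h : (i : ℕ) + 1 < m then PiLp.proj 2 (fun _ : Fin m => J) ⟨i + 1, h⟩
      else V ∘L PiLp.proj 2 (fun _ : Fin m => J) ⟨0, i.pos⟩

theorem cyclicShift_apply {J : Type*} [NormedAddCommGroup J] [InnerProductSpace ℂ J]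
    (m : ℕ) (V : J →L[ℂ] J) (ξ : PiLp 2 (fun _ : Fin m => J)) (i : Fin m) :
    cyclicShift m V ξ i =
      if h : (i : ℕ) + 1 < m then ξ ⟨i + 1, h⟩ else V (ξ ⟨0, i.pos⟩) := by
  by_cases h : (i : ℕ) + 1 < m <;> simp [cyclicShift, h]

/-! ### Crossed products by finite groups -/

/-- The *-algebra of matrices `M ∈ M_G(A)` with `M (k g) (k h) = α_k (M g h)`. Such a matrix is
determined by its row at `1`, that is, by a family `(a_s)` of elements of `A` indexed by `G`, and
has the entry `α_g (a_s)` at `(g, g s)`. -/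
def equivariantMatrices {A : Type*} [CStarAlgebra A] {G : Type*} [Group G] [Fintype G]
    [DecidableEq G] (α : G →* (A ≃⋆ₐ[ℂ] A)) : StarSubalgebra ℂ (CStarMatrix G G A) where
  carrier := {M | ∀ k g h : G, M (k * g) (k * h) = α k (M g h)}
  mul_mem' {M N} hM hN k g h := by
    rw [CStarMatrix.mul_apply, CStarMatrix.mul_apply, map_sum,
      ← Equiv.sum_comp (Equiv.mulLeft k)]
    exact Finset.sum_congr rfl fun x _ => by simp [hM k g x, hN k x h]
  one_mem' k g h := by
    by_cases hgh : g = h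
    · simp [hgh, CStarMatrix.one_apply]
    · simp [hgh]
  add_mem' {M N} hM hN k g h := by simp [hM k g h, hN k g h]
  zero_mem' k g h := (map_zero (α k)).symm
  algebraMap_mem' c k g h := by
    by_cases hgh : g = h
    · simp [Algebra.algebraMap_eq_smul_one, hgh]
    · simp [Algebra.algebraMap_eq_smul_one, CStarMatrix.one_apply_ne, hgh]
  star_mem' {M} hM k g h := by
    rw [CStarMatrix.star_apply, CStarMatrix.star_apply, hM k h g, map_star]

/-- The crossed product `A ⋊_α G` of a unital C*-algebra by an action of a finite group, realized
faithfully in `M_G(A)`. Its defining universal property is `CrossedProduct.existsUnique_lift`, and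
`CrossedProduct.eq_sum` says that it is spanned by the `A U^s`. -/
def CrossedProduct {A : Type*} [CStarAlgebra A] {G : Type*} [Group G] [Fintype G]
    [DecidableEq G] (α : G →* (A ≃⋆ₐ[ℂ] A)) : Type _ :=
  equivariantMatrices α

namespace CrossedProduct

section

variable {A : Type*} [CStarAlgebra A] {G : Type*} [Group G] [Fintype G]
  [DecidableEq G] (α : G →* (A ≃⋆ₐ[ℂ] A))

/-- The C*-algebra structure inherited from `M_G(A)`. -/
noncomputable instance : CStarAlgebra (CrossedProduct α) :=
  letI : PartialOrder A := CStarAlgebra.spectralOrder A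
  haveI : StarOrderedRing A := CStarAlgebra.spectralOrderedRing A
  haveI : IsClosed (equivariantMatrices α : Set (CStarMatrix G G A)) := by
    have hent : ∀ g h : G, Continuous fun M : CStarMatrix G G A => M g h := fun g h =>
      (continuous_apply h).comp (continuous_apply (A := fun _ : G => G → A) g)
    have hα : ∀ k, Continuous (α k) := fun k => (StarAlgEquiv.isometry (α k)).continuous
    have : (equivariantMatrices α : Set (CStarMatrix G G A)) =
        ⋂ (k : G) (g : G) (h : G), {M | M (k * g) (k * h) = α k (M g h)} := by
      ext M
      simp only [Set.mem_iInter]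
      rfl
    rw [this]
    exact isClosed_iInter fun k => isClosed_iInter fun g => isClosed_iInter fun h =>
      isClosed_eq (hent _ _) ((hα k).comp (hent g h))
  inferInstanceAs (CStarAlgebra (equivariantMatrices α))

variable {α}

/-- The coefficient `a_s` of `x = ∑ a_s U^s`, which is the entry of `x` at `(1, s)`. -/
def coeff (x : CrossedProduct α) (s : G) : A := Subtype.val x 1 s

variable (α) in
/-- The element `∑ a_s U^s` of the crossed product: the matrix with the entry `α_g (a_s)` at
`(g, g s)`. -/
def ofCoeff (f : G → A) : CrossedProduct α :=
  ⟨CStarMatrix.ofMatrix (Matrix.of fun g h => α g (f (g⁻¹ * h))), fun k g h => by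
    simp [mul_assoc]⟩

@[simp] theorem coeff_ofCoeff (f : G → A) (s : G) : (ofCoeff α f).coeff s = f s := by
  simp [coeff, ofCoeff]

theorem entry_eq (x : CrossedProduct α) (g h : G) :
    Subtype.val x g h = α g (x.coeff (g⁻¹ * h)) := by
  have hx := Subtype.property x g 1 (g⁻¹ * h)
  rwa [mul_one, mul_inv_cancel_left] at hx

theorem ext_coeff {x y : CrossedProduct α} (hxy : ∀ s, x.coeff s = y.coeff s) : x = y := by
  apply Subtype.ext
  ext g h
  rw [entry_eq x, entry_eq y, hxy]

theorem coeff_zero (s : G) : (0 : CrossedProduct α).coeff s = 0 := rfl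

theorem coeff_add (x y : CrossedProduct α) (s : G) :
    (x + y).coeff s = x.coeff s + y.coeff s := rfl

theorem coeff_sum {ι : Type*} (S : Finset ι) (x : ι → CrossedProduct α) (s : G) :
    (∑ i ∈ S, x i).coeff s = ∑ i ∈ S, (x i).coeff s :=
  map_sum (AddMonoidHom.mk' (fun y : CrossedProduct α => y.coeff s) fun y z => coeff_add y z s) x S

theorem coeff_smul (c : ℂ) (x : CrossedProduct α) (s : G) :
    (c • x).coeff s = c • x.coeff s := rfl

theorem coeff_one (s : G) : (1 : CrossedProduct α).coeff s = if s = 1 then 1 else 0 := by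
  change (1 : CStarMatrix G G A) 1 s = _
  by_cases hs : s = 1
  · simp [hs, CStarMatrix.one_apply]
  · simp [hs, Ne.symm hs]

theorem coeff_mul (x y : CrossedProduct α) (s : G) :
    (x * y).coeff s = ∑ t, x.coeff t * α t (y.coeff (t⁻¹ * s)) := by
  change (Subtype.val x * Subtype.val y : CStarMatrix G G A) 1 s = _
  rw [CStarMatrix.mul_apply]
  exact Finset.sum_congr rfl fun t _ => by rw [entry_eq y]; rfl

theorem coeff_star (x : CrossedProduct α) (s : G) :
    (star x).coeff s = star (α s (x.coeff s⁻¹)) := by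
  change (star (Subtype.val x) : CStarMatrix G G A) 1 s = _
  rw [CStarMatrix.star_apply, entry_eq x, mul_one]

variable (α)

/-- The canonical copy of `A` in the crossed product: `a` is the diagonal matrix with the entries
`α_g (a)`. -/
noncomputable def embed : A →⋆ₐ[ℂ] CrossedProduct α where
  toFun a := ofCoeff α fun s => if s = 1 then a else 0
  map_one' := ext_coeff fun s => by simp [coeff_one]
  map_mul' a b := ext_coeff fun s => by
    simp only [coeff_mul, coeff_ofCoeff, ite_mul, zero_mul, Finset.sum_ite_eq', Finset.mem_univ,
      if_true]
    by_cases hs : s = 1 <;> simp [hs]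
  map_zero' := ext_coeff fun s => by simp [coeff_zero]
  map_add' a b := ext_coeff fun s => by
    by_cases hs : s = 1 <;> simp [coeff_add, hs]
  commutes' c := ext_coeff fun s => by
    by_cases hs : s = 1 <;> simp [Algebra.algebraMap_eq_smul_one, coeff_smul, coeff_one, hs]
  map_star' a := ext_coeff fun s => by
    by_cases hs : s = 1 <;> simp [coeff_star, hs]

theorem coeff_embed (a : A) (s : G) : (embed α a).coeff s = if s = 1 then a else 0 :=
  coeff_ofCoeff (fun t => if t = 1 then a else 0) s

/-- The matrix with the entry `1` at `(g, g s)` for every `g`, and zero elsewhere. -/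
noncomputable def shift (s : G) : CrossedProduct α := ofCoeff α fun t => if t = s then 1 else 0

theorem coeff_shift (s t : G) : (shift α s).coeff t = if t = s then 1 else 0 :=
  coeff_ofCoeff _ t

theorem shift_one : shift α 1 = 1 := ext_coeff fun s => by rw [coeff_shift, coeff_one]

theorem shift_mul (s t : G) : shift α s * shift α t = shift α (s * t) := ext_coeff fun r => by
  simp only [coeff_mul, coeff_shift, ite_mul, zero_mul, one_mul, Finset.sum_ite_eq',
    Finset.mem_univ, if_true]
  by_cases hr : r = s * t
  · simp [hr]
  · have : ¬ s⁻¹ * r = t := fun h => hr (by rw [← h, mul_inv_cancel_left])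
    simp [hr, this]

theorem star_shift (s : G) : star (shift α s) = shift α s⁻¹ := ext_coeff fun r => by
  simp only [coeff_star, coeff_shift, inv_eq_iff_eq_inv]
  by_cases hr : r = s⁻¹ <;> simp [hr]

/-- The canonical unitaries `U^s` of the crossed product. -/
noncomputable def canonicalUnitary : G →* unitary (CrossedProduct α) where
  toFun s := ⟨shift α s, by
    rw [Unitary.mem_iff, star_shift, shift_mul, shift_mul]
    simp [shift_one]⟩
  map_one' := Subtype.ext (shift_one α)
  map_mul' s t := Subtype.ext (shift_mul α s t).symm

theorem coeff_canonicalUnitary (s t : G) :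
    (canonicalUnitary α s : CrossedProduct α).coeff t = if t = s then 1 else 0 :=
  coeff_shift α s t

theorem star_canonicalUnitary (s : G) :
    star (canonicalUnitary α s : CrossedProduct α) = canonicalUnitary α s⁻¹ :=
  star_shift α s

theorem coeff_embed_mul (a : A) (x : CrossedProduct α) (s : G) :
    (embed α a * x).coeff s = a * x.coeff s := by
  simp only [coeff_mul, coeff_embed, ite_mul, zero_mul, Finset.sum_ite_eq', Finset.mem_univ,
    if_true]
  simp

/-- Every element of the crossed product is `∑ a_s U^s`, where `a_s` is its `s`-th coefficient. -/
theorem eq_sum (x : CrossedProduct α) :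
    x = ∑ s, embed α (x.coeff s) * canonicalUnitary α s := by
  refine ext_coeff fun t => ?_
  simp [coeff_sum, coeff_embed_mul, coeff_canonicalUnitary]

/-- The covariance relation `U^s a (U^s)* = α_s (a)`. -/
theorem covariance (s : G) (a : A) :
    (canonicalUnitary α s : CrossedProduct α) * embed α a * star (canonicalUnitary α s :
      CrossedProduct α) = embed α (α s a) := by
  rw [star_canonicalUnitary]
  refine ext_coeff fun t => ?_
  simp only [mul_assoc, coeff_mul _ (embed α a * _), coeff_canonicalUnitary, coeff_embed_mul,
    coeff_embed, ite_mul, zero_mul, one_mul, Finset.sum_ite_eq', Finset.mem_univ, if_true]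
  by_cases ht : t = 1 <;> simp [ht]

/-- The universal property of the crossed product: every covariant representation of `(A, α, G)`
in a unital *-algebra extends uniquely to the crossed product. -/
theorem existsUnique_lift {B : Type*} [Ring B] [StarRing B] [Algebra ℂ B] (ρ : A →⋆ₐ[ℂ] B)
    (V : G →* unitary B)
    (hV : ∀ (s : G) (a : A), (V s : B) * ρ a * star (V s : B) = ρ (α s a)) :
    ∃! Φ : CrossedProduct α →⋆ₐ[ℂ] B,
      (∀ a, Φ (embed α a) = ρ a) ∧ ∀ s, Φ (canonicalUnitary α s) = V s := by
  have hcomm : ∀ (s : G) (a : A), (V s : B) * ρ a = ρ (α s a) * V s := fun s a => by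
    rw [← hV, mul_assoc, Unitary.coe_star_mul_self, mul_one]
  have hstar : ∀ s, star (V s : B) = V s⁻¹ := fun s => by
    rw [map_inv, ← Unitary.star_eq_inv]; rfl
  refine ⟨⟨⟨⟨⟨⟨fun x => ∑ s, ρ (x.coeff s) * V s, ?_⟩, ?_⟩, ?_, ?_⟩, ?_⟩, ?_⟩, ⟨?_, ?_⟩, ?_⟩
  · simp [coeff_one, apply_ite ρ]
  · intro x y
    simp only [coeff_mul, map_sum, map_mul, Finset.sum_mul, Finset.mul_sum]
    rw [Finset.sum_comm]
    nth_rewrite 2 [Finset.sum_comm]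
    refine Finset.sum_congr rfl fun t _ => ?_
    rw [← Equiv.sum_comp (Equiv.mulLeft t)]
    refine Finset.sum_congr rfl fun r _ => ?_
    simp only [Equiv.coe_mulLeft, inv_mul_cancel_left, map_mul, Submonoid.coe_mul]
    rw [mul_assoc, mul_assoc, ← mul_assoc _ (V t : B) (V r : B), ← hcomm]
    simp only [mul_assoc]
  · simp [coeff_zero]
  · intro x y
    simp [coeff_add, add_mul, Finset.sum_add_distrib]
  · intro c
    simp [Algebra.algebraMap_eq_smul_one, coeff_smul, coeff_one, apply_ite ρ]
  · intro x
    simp only [star_sum, coeff_star, star_mul]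
    rw [← Equiv.sum_comp (Equiv.inv G)]
    refine Finset.sum_congr rfl fun s _ => ?_
    rw [hstar, ← map_star ρ, hcomm, map_star (α s⁻¹), Equiv.inv_apply, inv_inv]
  · intro a
    simp [coeff_embed, apply_ite ρ]
  · intro s
    simp [coeff_canonicalUnitary, apply_ite ρ]
  · rintro Φ ⟨h1, h2⟩
    ext x
    conv_lhs => rw [eq_sum α x]
    simp [h1, h2]

end

end CrossedProduct

/-- A representation of the crossed product `A ⋊_α G` is minimal when it is irreducible and its
restriction to `A` is irreducible. -/
def IsMinimalRep {A : Type*} [CStarAlgebra A] {G : Type*} [Group G] [Fintype G]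
    [DecidableEq G] {α : G →* (A ≃⋆ₐ[ℂ] A)}
    {H : Type*} [NormedAddCommGroup H] [InnerProductSpace ℂ H] [CompleteSpace H]
    (P : CrossedProduct α →⋆ₐ[ℂ] (H →L[ℂ] H)) : Prop :=
  IsIrreducibleRep P ∧ IsIrreducibleRep (P.comp (CrossedProduct.embed α))

/-! ### Automorphisms of finite period -/

/-- The action of `ℤ/n` generated by an automorphism of period `n`. -/
def cyclicAction {A : Type*} [CStarAlgebra A] (σ : A ≃⋆ₐ[ℂ] A) (n : ℕ) (hσ : σ ^ n = 1) :
    Multiplicative (ZMod n) →* (A ≃⋆ₐ[ℂ] A) :=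
  AddMonoidHom.toMultiplicativeLeft
    (ZMod.lift n ⟨zmultiplesHom (Additive (A ≃⋆ₐ[ℂ] A)) (Additive.ofMul σ), by
      simp [← ofMul_pow, hσ]⟩)

theorem cyclicAction_apply {A : Type*} [CStarAlgebra A] (σ : A ≃⋆ₐ[ℂ] A) (n : ℕ)
    (hσ : σ ^ n = 1) (z : ℤ) :
    cyclicAction σ n hσ (Multiplicative.ofAdd (z : ZMod n)) = σ ^ z := by
  simp [cyclicAction]

theorem pow_pow_eq_one_of_mul_eq {M : Type*} [Monoid M] {σ : M} {k m n : ℕ} (hkm : k * m = n)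
    (hσ : σ ^ n = 1) : (σ ^ m) ^ k = 1 := by
  rw [← pow_mul, mul_comm, hkm, hσ]

/-- The crossed product `A ⋊_σ ℤ/n` by an automorphism of period `n`. -/
abbrev CyclicCrossedProduct {A : Type*} [CStarAlgebra A] (σ : A ≃⋆ₐ[ℂ] A) (n : ℕ) [NeZero n]
    (hσ : σ ^ n = 1) : Type _ :=
  CrossedProduct (cyclicAction σ n hσ)

/-- The canonical copy of `A` in `A ⋊_σ ℤ/n`. -/
noncomputable abbrev cyclicEmbed {A : Type*} [CStarAlgebra A] (σ : A ≃⋆ₐ[ℂ] A) (n : ℕ) [NeZero n]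
    (hσ : σ ^ n = 1) : A →⋆ₐ[ℂ] CyclicCrossedProduct σ n hσ :=
  CrossedProduct.embed (cyclicAction σ n hσ)

/-- The canonical unitary `U = U^1` of `A ⋊_σ ℤ/n`. -/
noncomputable def cyclicUnitary {A : Type*} [CStarAlgebra A] (σ : A ≃⋆ₐ[ℂ] A) (n : ℕ) [NeZero n]
    (hσ : σ ^ n = 1) : unitary (CyclicCrossedProduct σ n hσ) :=
  CrossedProduct.canonicalUnitary (cyclicAction σ n hσ) (Multiplicative.ofAdd (1 : ZMod n))

/-- The fixed-point algebra `A₁ = {a | σ a = a}`. -/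
def fixedPointAlgebra {A : Type*} [CStarAlgebra A] (σ : A ≃⋆ₐ[ℂ] A) : StarSubalgebra ℂ A where
  carrier := {a | σ a = a}
  mul_mem' {a b} (ha : σ a = a) (hb : σ b = b) := by
    change σ (a * b) = a * b
    rw [map_mul, ha, hb]
  add_mem' {a b} (ha : σ a = a) (hb : σ b = b) := by
    change σ (a + b) = a + b
    rw [map_add, ha, hb]
  algebraMap_mem' c := by
    change σ (algebraMap ℂ A c) = algebraMap ℂ A c
    rw [Algebra.algebraMap_eq_smul_one, map_smul, map_one]
  star_mem' {a} (ha : σ a = a) := by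
    change σ (star a) = star a
    rw [map_star, ha]

/-- The representation `π₁ ∘ σⁱ`. -/
noncomputable def twistRep {A : Type*} [CStarAlgebra A] (σ : A ≃⋆ₐ[ℂ] A)
    {J : Type*} [NormedAddCommGroup J] [InnerProductSpace ℂ J] [CompleteSpace J]
    (π₁ : A →⋆ₐ[ℂ] (J →L[ℂ] J)) (i : ℕ) : A →⋆ₐ[ℂ] (J →L[ℂ] J) :=
  π₁.comp (σ ^ i).toStarAlgHom

@[simp] theorem twistRep_apply {A : Type*} [CStarAlgebra A] (σ : A ≃⋆ₐ[ℂ] A)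
    {J : Type*} [NormedAddCommGroup J] [InnerProductSpace ℂ J] [CompleteSpace J]
    (π₁ : A →⋆ₐ[ℂ] (J →L[ℂ] J)) (i : ℕ) (a : A) :
    twistRep σ π₁ i a = π₁ ((σ ^ i) a) := rfl

/-- The data from which an irreducible representation of `A ⋊_σ ℤ/(km)` is built: an irreducible
representation `π₁` of `A` that is not equivalent to `π₁ ∘ σⁱ` for `0 < i < m`, and a unitary `V`
with `V ^ k = 1` and `V π₁(·) V* = π₁ ∘ σᵐ`. -/
structure IsCyclicDatum {A : Type*} [CStarAlgebra A] (σ : A ≃⋆ₐ[ℂ] A) (k m : ℕ)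
    {J : Type*} [NormedAddCommGroup J] [InnerProductSpace ℂ J] [CompleteSpace J]
    (π₁ : A →⋆ₐ[ℂ] (J →L[ℂ] J)) (V : unitary (J →L[ℂ] J)) : Prop where
  irreducible : IsIrreducibleRep π₁
  pow_eq_one : V ^ k = 1
  implements : ∀ a : A,
    (V : J →L[ℂ] J) * π₁ a * star (V : J →L[ℂ] J) = twistRep σ π₁ m a
  inequivalent : ∀ i : ℕ, 0 < i → i < m → ¬ UnitarilyEquivalent π₁ (twistRep σ π₁ i)

/-- The representation `P` of `A ⋊_σ ℤ/n` on `J ⊕ ⋯ ⊕ J` (`m` copies) sends `a ∈ A` to the diagonal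
operator `π₁(a) ⊕ π₁(σ a) ⊕ ⋯ ⊕ π₁(σ^{m-1} a)` and `U` to the cyclic shift with `V` in the
corner. -/
def IsCyclicForm {A : Type*} [CStarAlgebra A] (σ : A ≃⋆ₐ[ℂ] A) (n : ℕ) [NeZero n]
    (hσ : σ ^ n = 1) (m : ℕ)
    {J : Type*} [NormedAddCommGroup J] [InnerProductSpace ℂ J] [CompleteSpace J]
    (π₁ : A →⋆ₐ[ℂ] (J →L[ℂ] J)) (V : unitary (J →L[ℂ] J))
    (P : CyclicCrossedProduct σ n hσ →⋆ₐ[ℂ]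
      (PiLp 2 (fun _ : Fin m => J) →L[ℂ] PiLp 2 (fun _ : Fin m => J))) : Prop :=
  (∀ a : A, P (cyclicEmbed σ n hσ a) = directSumRep (fun i : Fin m => twistRep σ π₁ i) a) ∧
    P (cyclicUnitary σ n hσ) = cyclicShift m (V : J →L[ℂ] J)

/-!
For `⇐` in the description of irreducible representations, and for the first assertions about a
datum: an operator commuting with a representation of cyclic form has, by Schur's lemma
(`IsIrreducibleRep.exists_eq_smul`, `IsIrreducibleRep.unitarilyEquivalent_of_intertwiner`), a
diagonal matrix of scalars, because the twists `π₁ ∘ σⁱ` with `i < m` are inequivalent; commuting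
with the shift makes it a scalar. Schur's lemma itself is obtained from the continuous functional
calculus.

For `⇒`, let `P` be irreducible. If `p` projects onto a closed `A`-invariant subspace, `∑ₛ Uˢ p U⁻ˢ`
is a scalar, and this scalar drops by at least `1` when the subspace shrinks; hence there is a
closed subspace on which `A` acts irreducibly
(`CrossedProduct.exists_isIrreducibleRep_subRep`). Call this representation `π₁`, let `m` be the
smallest positive integer for which `π₁ ∘ σᵐ` is equivalent to `π₁`, and let `V` be a unitary that
implements the equivalence, with `V ^ k = 1`. The map `S ↦ Uᵐ S V*` on the intertwiners from `π₁` to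
`P` has finite order, so it has an eigenvector `S`, and after a change of `V` by a root of unity
`Uᵐ S = S V` (`exists_intertwiner`). Then `ξ ↦ ∑ᵢ U⁻ⁱ S ξᵢ` is a nonzero intertwiner from the
representation of cyclic form to `P`, and both are irreducible.

For the fixed-point algebra `A₁`, the space of `π₁` is the direct sum of the eigenspaces of `V`,
all invariant under `A₁`, and `π₁ ∘ σⁱ = π₁` on `A₁`. If the `xⱼ` are linearly independent, then
`∑ᵢ ∑ⱼ ⟪yⱼ, π₁(σⁱ a) xⱼ⟫ = 0` for all `a` forces `y = 0` (`eq_zero_of_sum_inner_twistRep`). When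
`xⱼ` and `yⱼ` are eigenvectors of `V` for the same eigenvalue, averaging over the powers of `σ`
shows that it is enough to have `∑ⱼ ⟪yⱼ, π₁(b) xⱼ⟫ = 0` for `b ∈ A₁`
(`IsCyclicDatum.eq_zero_of_sum_inner_fixedPointAlgebra`). A single vector `x` gives the
irreducibility of the eigenspaces. The pair `x, W x`, with `W` an equivalence between two
eigenspaces, gives their inequivalence.
-/

section GeneralRepresentations

variable {B : Type*} [Ring B] [StarRing B] [Algebra ℂ B]
  {H : Type*} [NormedAddCommGroup H] [InnerProductSpace ℂ H] [CompleteSpace H]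
  {H' : Type*} [NormedAddCommGroup H'] [InnerProductSpace ℂ H'] [CompleteSpace H']
  {H'' : Type*} [NormedAddCommGroup H''] [InnerProductSpace ℂ H''] [CompleteSpace H'']

/-! ### Unitary equivalence and intertwiners -/

theorem UnitarilyEquivalent.refl (ρ : B →⋆ₐ[ℂ] (H →L[ℂ] H)) : UnitarilyEquivalent ρ ρ :=
  ⟨LinearIsometryEquiv.refl ℂ H, fun _ _ => rfl⟩

theorem UnitarilyEquivalent.symm {ρ : B →⋆ₐ[ℂ] (H →L[ℂ] H)} {ρ' : B →⋆ₐ[ℂ] (H' →L[ℂ] H')}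
    (h : UnitarilyEquivalent ρ ρ') : UnitarilyEquivalent ρ' ρ := by
  obtain ⟨W, hW⟩ := h
  refine ⟨W.symm, fun b x => ?_⟩
  rw [W.symm_apply_eq, hW, W.apply_symm_apply]

theorem UnitarilyEquivalent.trans {ρ : B →⋆ₐ[ℂ] (H →L[ℂ] H)} {ρ' : B →⋆ₐ[ℂ] (H' →L[ℂ] H')}
    {ρ'' : B →⋆ₐ[ℂ] (H'' →L[ℂ] H'')}
    (h : UnitarilyEquivalent ρ ρ') (h' : UnitarilyEquivalent ρ' ρ'') :
    UnitarilyEquivalent ρ ρ'' := by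
  obtain ⟨W, hW⟩ := h
  obtain ⟨W', hW'⟩ := h'
  exact ⟨W.trans W', fun b x => by simp [hW, hW']⟩

theorem UnitarilyEquivalent.comp {C : Type*} [Ring C] [StarRing C] [Algebra ℂ C]
    {ρ : B →⋆ₐ[ℂ] (H →L[ℂ] H)} {ρ' : B →⋆ₐ[ℂ] (H' →L[ℂ] H')}
    (h : UnitarilyEquivalent ρ ρ') (f : C →⋆ₐ[ℂ] B) :
    UnitarilyEquivalent (ρ.comp f) (ρ'.comp f) :=
  let ⟨W, hW⟩ := h
  ⟨W, fun b x => hW (f b) x⟩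

theorem UnitarilyEquivalent.isIrreducibleRep {ρ : B →⋆ₐ[ℂ] (H →L[ℂ] H)}
    {ρ' : B →⋆ₐ[ℂ] (H' →L[ℂ] H')} (h : UnitarilyEquivalent ρ ρ') (hρ : IsIrreducibleRep ρ) :
    IsIrreducibleRep ρ' := by
  obtain ⟨W, hW⟩ := h
  have := hρ.1
  refine ⟨W.symm.toEquiv.nontrivial, fun K hK hinv => ?_⟩
  have key := hρ.2 (K.comap (W.toLinearEquiv : H →ₗ[ℂ] H')) (hK.preimage W.continuous)
    fun b x hx => by
      change W (ρ b x) ∈ K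
      rw [hW]
      exact hinv b _ hx
  refine key.imp (fun h => ?_) fun h => ?_
  · rw [eq_bot_iff]
    intro x hx
    have : W.symm x ∈ K.comap (W.toLinearEquiv : H →ₗ[ℂ] H') := by
      change W (W.symm x) ∈ K
      rwa [W.apply_symm_apply]
    rw [h, Submodule.mem_bot] at this
    simpa using this
  · rw [eq_top_iff]
    intro x _
    have : W.symm x ∈ K.comap (W.toLinearEquiv : H →ₗ[ℂ] H') := h ▸ trivial
    change W (W.symm x) ∈ K at this
    rwa [W.apply_symm_apply] at this

theorem adjoint_intertwines {ρ : B →⋆ₐ[ℂ] (H →L[ℂ] H)} {ρ' : B →⋆ₐ[ℂ] (H' →L[ℂ] H')}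
    {T : H →L[ℂ] H'} (hT : ∀ b x, T (ρ b x) = ρ' b (T x)) (b : B) (y : H') :
    T.adjoint (ρ' b y) = ρ b (T.adjoint y) := by
  refine ext_inner_right ℂ fun x => ?_
  have h1 : ∀ u v, inner ℂ (ρ b u) v = inner ℂ u (ρ (star b) v) := fun u v => by
    rw [map_star, ContinuousLinearMap.star_eq_adjoint, ContinuousLinearMap.adjoint_inner_right]
  have h2 : ∀ u v, inner ℂ (ρ' b u) v = inner ℂ u (ρ' (star b) v) := fun u v => by
    rw [map_star, ContinuousLinearMap.star_eq_adjoint, ContinuousLinearMap.adjoint_inner_right]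
  rw [h1, ContinuousLinearMap.adjoint_inner_left, ContinuousLinearMap.adjoint_inner_left, h2, hT]

/-- The orthogonal complement of an invariant subspace is invariant, so that the orthogonal
projection onto a closed invariant subspace commutes with the representation. -/
theorem starProjection_commutes (ρ : B →⋆ₐ[ℂ] (H →L[ℂ] H)) (K : Submodule ℂ H)
    [K.HasOrthogonalProjection] (hK : ∀ b, ∀ x ∈ K, ρ b x ∈ K) (b : B) (x : H) :
    K.starProjection (ρ b x) = ρ b (K.starProjection x) := by
  refine Submodule.eq_starProjection_of_mem_of_inner_eq_zero
    (hK b _ (K.starProjection_apply_mem x)) fun w hw => ?_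
  rw [← map_sub, ← ContinuousLinearMap.adjoint_inner_right, ← ContinuousLinearMap.star_eq_adjoint,
    ← map_star]
  exact K.starProjection_inner_eq_zero x _ (hK _ _ hw)

/-- The restriction of a representation to a closed invariant subspace. -/
noncomputable def subRep (ρ : B →⋆ₐ[ℂ] (H →L[ℂ] H)) (K : Submodule ℂ H) [CompleteSpace K]
    (hK : ∀ b, ∀ x ∈ K, ρ b x ∈ K) : B →⋆ₐ[ℂ] (K →L[ℂ] K) where
  toFun b := (ρ b ∘L K.subtypeL).codRestrict K fun x => hK b x x.2
  map_one' := by ext; simp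
  map_mul' a b := by ext; simp only [map_mul]; rfl
  map_zero' := by ext; simp
  map_add' a b := by ext; simp only [map_add]; rfl
  commutes' c := by ext; simp [Algebra.algebraMap_eq_smul_one]
  map_star' b := by
    rw [ContinuousLinearMap.star_eq_adjoint, ContinuousLinearMap.eq_adjoint_iff]
    intro x y
    change inner ℂ (ρ (star b) x) (y : H) = inner ℂ (x : H) (ρ b y)
    rw [map_star, ContinuousLinearMap.star_eq_adjoint, ContinuousLinearMap.adjoint_inner_left]

/-- The restriction to `K` is irreducible when every vector of `K` orthogonal to the orbit of a
nonzero vector of `K` vanishes. -/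
theorem isIrreducibleRep_subRep_of_orbit (ρ : B →⋆ₐ[ℂ] (H →L[ℂ] H)) (K : Submodule ℂ H)
    [CompleteSpace K] (hK : ∀ b, ∀ x ∈ K, ρ b x ∈ K) (hne : K ≠ ⊥)
    (h : ∀ x ∈ K, x ≠ 0 → ∀ y ∈ K, (∀ b, inner ℂ y (ρ b x) = 0) → y = 0) :
    IsIrreducibleRep (subRep ρ K hK) := by
  refine ⟨Submodule.nontrivial_iff_ne_bot.2 hne, fun L hL hinv => ?_⟩
  have : CompleteSpace L := hL.completeSpace_coe
  rw [or_iff_not_imp_left]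
  intro hL0
  obtain ⟨x, hx, hx0⟩ := L.ne_bot_iff.1 hL0
  rw [← Submodule.orthogonal_eq_bot_iff, eq_bot_iff]
  intro y hy
  refine Subtype.ext (h x x.2 (by simpa using hx0) y y.2 fun b => ?_)
  exact inner_eq_zero_symm.1 ((L.mem_orthogonal y).1 hy _ (hinv b x hx))

/-! ### Schur's lemma -/

/-- A self-adjoint operator `T` with two points `a < b` in its spectrum has a nontrivial closed
subspace that is invariant under its commutant: the kernel of `(T - c)₊` with `a < c < b`. -/
theorem IsIrreducibleRep.exists_eq_smul_of_isSelfAdjoint {ρ : B →⋆ₐ[ℂ] (H →L[ℂ] H)}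
    (hρ : IsIrreducibleRep ρ) {T : H →L[ℂ] H} (hsa : IsSelfAdjoint T)
    (hT : ∀ b, Commute T (ρ b)) : ∃ c : ℝ, T = (c : ℂ) • (1 : H →L[ℂ] H) := by
  have := hρ.1
  obtain ⟨a, ha⟩ := ContinuousFunctionalCalculus.spectrum_nonempty (R := ℝ) T hsa
  refine ⟨a, ?_⟩
  suffices hsub : spectrum ℝ T ⊆ {a} by
    have := CFC.eq_algebraMap_of_spectrum_subset_singleton T a hsub hsa
    rw [this, Algebra.algebraMap_eq_smul_one]
    ext; simp
  suffices H : ∀ a ∈ spectrum ℝ T, ∀ b ∈ spectrum ℝ T, ¬ a < b from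
    fun b hb => le_antisymm (not_lt.1 (H a ha b hb)) (not_lt.1 (H b hb a ha))
  intro a ha b hb hab
  let f : ℝ → ℝ := fun t => max (t - (a + b) / 2) 0
  let g : ℝ → ℝ := fun t => max ((a + b) / 2 - t) 0
  have hf : Continuous f := by fun_prop
  have hg : Continuous g := by fun_prop
  have hfg : cfc f T * cfc g T = 0 := by
    rw [← cfc_mul f g T hf.continuousOn hg.continuousOn]
    have : (fun x => f x * g x) = fun _ => 0 := by
      funext t
      rcases le_total t ((a + b) / 2) with h | h
      · simp [f, max_eq_right (sub_nonpos.2 h)]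
      · simp [g, max_eq_right (sub_nonpos.2 h)]
    rw [this, cfc_const_zero]
  have hne : ∀ (h : ℝ → ℝ), Continuous h → ∀ t ∈ spectrum ℝ T, h t ≠ 0 → cfc h T ≠ 0 := by
    intro h hh t ht hne h0
    have := cfc_map_spectrum (R := ℝ) h T hsa hh.continuousOn
    rw [h0, spectrum.zero_eq] at this
    have hm : h t ∈ h '' spectrum ℝ T := Set.mem_image_of_mem h ht
    rw [← this] at hm
    exact hne hm
  obtain ⟨F, hF⟩ : ∃ F : H →L[ℂ] H, F = cfc f T := ⟨_, rfl⟩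
  obtain ⟨G, hG⟩ : ∃ G : H →L[ℂ] H, G = cfc g T := ⟨_, rfl⟩
  have hfT : F ≠ 0 := hF ▸ hne f hf b hb (by simp only [f]; rw [max_eq_left] <;> linarith)
  have hgT : G ≠ 0 := hG ▸ hne g hg a ha (by simp only [g]; rw [max_eq_left] <;> linarith)
  rw [← hF, ← hG] at hfg
  rcases hρ.2 (LinearMap.ker (F : H →ₗ[ℂ] H)) F.isClosed_ker (fun b x hx => by
      have hc : Commute F (ρ b) := hF ▸ (hT b).cfc_real f
      have hx' : F x = 0 := hx
      change (F * ρ b) x = 0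
      rw [hc.eq, mul_apply_eq_comp, hx', map_zero]) with h | h
  · refine hgT (ContinuousLinearMap.ext fun x => ?_)
    have : G x ∈ LinearMap.ker (F : H →ₗ[ℂ] H) := DFunLike.congr_fun hfg x
    rwa [h] at this
  · refine hfT (ContinuousLinearMap.ext fun x => ?_)
    have : x ∈ LinearMap.ker (F : H →ₗ[ℂ] H) := h ▸ trivial
    exact this

/-- The commutant of an irreducible representation consists of the scalars. -/
theorem IsIrreducibleRep.exists_eq_smul {ρ : B →⋆ₐ[ℂ] (H →L[ℂ] H)}
    (hρ : IsIrreducibleRep ρ) {T : H →L[ℂ] H} (hT : ∀ b x, T (ρ b x) = ρ b (T x)) :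
    ∃ c : ℂ, ∀ x, T x = c • x := by
  have h1 : ∀ b, Commute T (ρ b) := fun b => ContinuousLinearMap.ext (hT b)
  have h2 : ∀ b, Commute (star T) (ρ b) := fun b =>
    ContinuousLinearMap.ext (adjoint_intertwines hT b)
  obtain ⟨r, hr⟩ := hρ.exists_eq_smul_of_isSelfAdjoint (realPart T).2 fun b => by
    rw [realPart_apply_coe]
    exact ((h1 b).add_left (h2 b)).smul_left _
  obtain ⟨s, hs⟩ := hρ.exists_eq_smul_of_isSelfAdjoint (imaginaryPart T).2 fun b => by
    rw [imaginaryPart_apply_coe]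
    exact (((h1 b).sub_left (h2 b)).smul_left _).smul_left _
  refine ⟨r + Complex.I * s, fun x => ?_⟩
  conv_lhs => rw [← realPart_add_I_smul_imaginaryPart T, hr, hs]
  simp [add_smul, mul_smul]

/-- By Schur's lemma `T* T` and `T T*` are multiples of the identity, by the same positive scalar,
so a multiple of `T` is unitary. -/
theorem IsIrreducibleRep.unitarilyEquivalent_of_intertwiner {ρ : B →⋆ₐ[ℂ] (H →L[ℂ] H)}
    {ρ' : B →⋆ₐ[ℂ] (H' →L[ℂ] H')} (hρ : IsIrreducibleRep ρ) (hρ' : IsIrreducibleRep ρ')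
    {T : H →L[ℂ] H'} (hT : ∀ b x, T (ρ b x) = ρ' b (T x)) (hT0 : T ≠ 0) :
    UnitarilyEquivalent ρ ρ' := by
  obtain ⟨c, hc⟩ := hρ.exists_eq_smul (T := T.adjoint ∘L T) fun b x => by
    simp [hT, adjoint_intertwines hT]
  obtain ⟨d, hd⟩ := hρ'.exists_eq_smul (T := T ∘L T.adjoint) fun b x => by
    simp [hT, adjoint_intertwines hT]
  simp only [ContinuousLinearMap.comp_apply] at hc hd
  obtain ⟨x₀, hx₀⟩ : ∃ x, T x ≠ 0 := by
    by_contra! h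
    exact hT0 (ContinuousLinearMap.ext h)
  have hcd : c = d := by
    have h := hd (T x₀)
    rw [hc, map_smul] at h
    exact smul_left_injective ℂ hx₀ h
  have hnorm : ∀ x, (‖T x‖ : ℂ) ^ 2 = c * (‖x‖ : ℂ) ^ 2 := fun x => by
    have := inner_self_eq_norm_sq_to_K (𝕜 := ℂ) (T x)
    rw [← ContinuousLinearMap.adjoint_inner_right, hc, inner_smul_right,
      inner_self_eq_norm_sq_to_K] at this
    exact this.symm
  have hx0 : x₀ ≠ 0 := fun h => hx₀ (by rw [h, map_zero])
  -- `c` is the square of the norm ratio at any vector, so that `r⁻¹ T` is isometric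
  obtain ⟨r, hr⟩ : ∃ r : ℝ, r = ‖T x₀‖ / ‖x₀‖ := ⟨_, rfl⟩
  have hr0 : 0 < r := by rw [hr]; exact div_pos (norm_pos_iff.2 hx₀) (norm_pos_iff.2 hx0)
  have hrc : c = (r : ℂ) ^ 2 := by
    have h : (‖x₀‖ : ℂ) ≠ 0 := by simpa using hx0
    rw [hr, Complex.ofReal_div, div_pow, hnorm]
    field_simp
  have hiso : ∀ x, ‖T x‖ = r * ‖x‖ := fun x => by
    have := hnorm x
    rw [hrc, ← mul_pow] at this
    norm_cast at this
    exact (pow_left_inj₀ (norm_nonneg _) (by positivity) two_ne_zero).1 this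
  have hrC : (r : ℂ) ≠ 0 := by exact_mod_cast hr0.ne'
  let f : H →ₗᵢ[ℂ] H' :=
    { toLinearMap := ((r : ℂ)⁻¹ • T : H →L[ℂ] H')
      norm_map' := fun x => by
        change ‖(r : ℂ)⁻¹ • T x‖ = ‖x‖
        rw [norm_smul, hiso, norm_inv, Complex.norm_real, Real.norm_of_nonneg hr0.le,
          inv_mul_cancel_left₀ hr0.ne'] }
  have hf : ∀ x, f x = (r : ℂ)⁻¹ • T x := fun _ => rfl
  have hsurj : Function.Surjective f := fun y => ⟨(r : ℂ)⁻¹ • T.adjoint y, by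
    rw [hf, map_smul, hd, smul_smul, smul_smul, ← hcd, hrc]
    field_simp
    simp⟩
  refine ⟨LinearIsometryEquiv.ofSurjective f hsurj, fun b x => ?_⟩
  change f _ = ρ' b (f x)
  rw [hf, hf, hT, map_smul]

/-- The projection onto a closed invariant subspace lies in the commutant. -/
theorem isIrreducibleRep_of_commutant [Nontrivial H] (ρ : B →⋆ₐ[ℂ] (H →L[ℂ] H))
    (h : ∀ T : H →L[ℂ] H, (∀ b x, T (ρ b x) = ρ b (T x)) → ∃ c : ℂ, ∀ x, T x = c • x) :
    IsIrreducibleRep ρ := by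
  refine ⟨inferInstance, fun K hK hinv => ?_⟩
  have : CompleteSpace K := hK.completeSpace_coe
  obtain ⟨c, hc⟩ := h K.starProjection (starProjection_commutes ρ K hinv)
  by_cases h0 : c = 0
  · left
    rw [eq_bot_iff]
    intro x hx
    rw [← K.starProjection_eq_self_iff, hc, h0, zero_smul] at hx
    exact hx.symm
  · right
    rw [eq_top_iff]
    intro x _
    have := K.starProjection_apply_mem (c⁻¹ • x)
    rwa [hc, smul_inv_smul₀ h0] at this

end GeneralRepresentations

/-! ### Endomorphisms of finite order -/

/-- An endomorphism of finite order of a complex vector space is diagonalizable: `x` is the sum of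
its components `k⁻¹ ∑ⱼ ζ^(-ij) T^j x`, where `ζ` is a primitive `k`-th root of unity. -/
theorem iSup_eigenspace_eq_top_of_pow_eq_one {M : Type*} [AddCommGroup M] [Module ℂ M]
    {k : ℕ} [NeZero k] {T : Module.End ℂ M} (hT : T ^ k = 1) :
    ⨆ μ : ℂ, T.eigenspace μ = ⊤ := by
  have hk : (k : ℂ) ≠ 0 := Nat.cast_ne_zero.2 (NeZero.ne k)
  obtain ⟨ζ, hζ⟩ : ∃ ζ : ℂ, IsPrimitiveRoot ζ k := ⟨_, Complex.isPrimitiveRoot_exp k (NeZero.ne k)⟩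
  have hTk : ∀ x, (T ^ k) x = x := fun x => by rw [hT]; rfl
  let y : M → ℂ → M := fun x μ => ∑ j ∈ Finset.range k, μ ^ j • (T ^ j) x
  -- multiplying by `μ T` shifts the index of the sum, cyclically since `μ ^ k = 1` and `T ^ k = 1`
  have hy : ∀ x, ∀ μ : ℂ, μ ^ k = 1 → y x μ ∈ T.eigenspace μ⁻¹ := fun x μ hμ => by
    have hμ0 : μ ≠ 0 := by rintro rfl; simp [NeZero.ne k] at hμ
    rw [Module.End.mem_eigenspace_iff, eq_inv_smul_iff₀ hμ0]
    have h1 : μ • T (y x μ) = ∑ j ∈ Finset.range k, μ ^ (j + 1) • (T ^ (j + 1)) x := by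
      simp only [y, map_sum, Finset.smul_sum, map_smul, smul_smul, ← pow_succ']
      exact Finset.sum_congr rfl fun j _ => by rw [pow_succ' T]; rfl
    have h2 := Finset.sum_range_succ' (fun j => μ ^ j • (T ^ j) x) k
    rw [Finset.sum_range_succ, hμ, hTk] at h2
    rw [h1]
    simpa [y] using h2.symm
  rw [eq_top_iff]
  intro x _
  -- the geometric sum `∑ᵢ (ζ ^ j) ^ i` vanishes unless `j = 0`
  have hx : x = (k : ℂ)⁻¹ • ∑ i ∈ Finset.range k, y x (ζ ^ i) := by
    rw [eq_inv_smul_iff₀ hk]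
    simp only [y]
    rw [Finset.sum_comm, Finset.sum_eq_single_of_mem 0 (Finset.mem_range.2 (NeZero.pos k))]
    · simp [Nat.cast_smul_eq_nsmul]
    · intro j hj hj0
      rw [← Finset.sum_smul]
      have hne : ζ ^ j ≠ 1 := hζ.pow_ne_one_of_pos_of_lt hj0 (Finset.mem_range.1 hj)
      have : (∑ i ∈ Finset.range k, (ζ ^ j) ^ i) = 0 := by
        have h := mul_geom_sum (ζ ^ j) k
        rw [← pow_mul, mul_comm j, pow_mul, hζ.pow_eq_one, one_pow, sub_self] at h
        exact (mul_eq_zero.1 h).resolve_left (sub_ne_zero.2 hne)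
      simp_rw [← pow_mul, mul_comm _ j, pow_mul, this, zero_smul]
  rw [hx]
  refine Submodule.smul_mem _ _ (Submodule.sum_mem _ fun i _ => ?_)
  exact Submodule.mem_iSup_of_mem _ (hy x (ζ ^ i) (by
    rw [← pow_mul, mul_comm, pow_mul, hζ.pow_eq_one, one_pow]))

theorem pow_eq_one_of_mem_eigenspace {M : Type*} [AddCommGroup M] [Module ℂ M]
    {k : ℕ} {T : Module.End ℂ M} (hT : T ^ k = 1) {μ : ℂ} {x : M} (hx : x ∈ T.eigenspace μ)
    (hx0 : x ≠ 0) : μ ^ k = 1 := by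
  rw [Module.End.mem_eigenspace_iff] at hx
  have : ∀ j : ℕ, (T ^ j) x = μ ^ j • x := fun j => by
    induction j with
    | zero => simp
    | succ j ih => rw [pow_succ', Module.End.mul_apply, ih, map_smul, hx, smul_smul, pow_succ]
  have h := this k
  rw [hT, Module.End.one_apply] at h
  exact smul_left_injective ℂ hx0 (by simpa using h.symm)

namespace CrossedProduct

variable {A : Type*} [CStarAlgebra A] {G : Type*} [Group G] [Fintype G]
  [DecidableEq G] {α : G →* (A ≃⋆ₐ[ℂ] A)}
  {H : Type*} [NormedAddCommGroup H] [InnerProductSpace ℂ H] [CompleteSpace H]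
  {H' : Type*} [NormedAddCommGroup H'] [InnerProductSpace ℂ H'] [CompleteSpace H']

/-! ### Restriction from a crossed product to the coefficient algebra -/

theorem canonicalUnitary_mul_embed (s : G) (a : A) :
    (canonicalUnitary α s : CrossedProduct α) * embed α a =
      embed α (α s a) * canonicalUnitary α s := by
  rw [← covariance, mul_assoc, Unitary.coe_star_mul_self, mul_one]

theorem intertwines_of_generators {P : CrossedProduct α →⋆ₐ[ℂ] (H →L[ℂ] H)}
    {P' : CrossedProduct α →⋆ₐ[ℂ] (H' →L[ℂ] H')} {T : H →L[ℂ] H'}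
    (hA : ∀ a x, T (P (embed α a) x) = P' (embed α a) (T x))
    (hU : ∀ s x, T (P (canonicalUnitary α s) x) = P' (canonicalUnitary α s) (T x))
    (b : CrossedProduct α) (x : H) : T (P b x) = P' b (T x) := by
  rw [eq_sum α b]
  simp only [map_sum, map_mul, sum_apply, mul_apply_eq_comp, hA, hU]

/-- Let `p` be the projection onto a closed subspace invariant under `A`. The sum of the translates
of `p` by the canonical unitaries lies in the commutant of the crossed product, so it is a
scalar. -/
theorem exists_sum_norm_sq_starProjection {P : CrossedProduct α →⋆ₐ[ℂ] (H →L[ℂ] H)}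
    (hP : IsIrreducibleRep P) (K : Submodule ℂ H) [CompleteSpace K]
    (hK : ∀ a, ∀ x ∈ K, P.comp (embed α) a x ∈ K) :
    ∃ c : ℝ, ∀ x,
      ∑ s, ‖K.starProjection (P (canonicalUnitary α s) x)‖ ^ 2 = c * ‖x‖ ^ 2 := by
  have hp : ∀ a x, K.starProjection (P (embed α a) x) = P (embed α a) (K.starProjection x) :=
    starProjection_commutes (P.comp (embed α)) K hK
  let S : H →L[ℂ] H := ∑ s, P (canonicalUnitary α s⁻¹) * (K.starProjection *
    P (canonicalUnitary α s))
  have hS : ∀ x, S x = ∑ s, P (canonicalUnitary α s⁻¹)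
      (K.starProjection (P (canonicalUnitary α s) x)) := fun x => by
    simp only [S, sum_apply, mul_apply_eq_comp]
  have hmul : ∀ (b b' : CrossedProduct α) x, P b (P b' x) = P (b * b') x := fun b b' x => by
    rw [map_mul, mul_apply_eq_comp]
  obtain ⟨c, hc⟩ := hP.exists_eq_smul (T := S) (intertwines_of_generators (fun a x => by
      rw [hS, hS, map_sum]
      refine Finset.sum_congr rfl fun s _ => ?_
      rw [hmul, canonicalUnitary_mul_embed, ← hmul, hp, hmul, canonicalUnitary_mul_embed, ← hmul]
      have h : α s⁻¹ * α s = 1 := by rw [← map_mul, inv_mul_cancel, map_one]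
      rw [show α s⁻¹ (α s a) = a from DFunLike.congr_fun h a]) fun t x => by
      rw [hS, hS, map_sum, eq_comm, ← Equiv.sum_comp (Equiv.mulRight t)]
      refine Finset.sum_congr rfl fun s _ => ?_
      rw [Equiv.coe_mulRight, hmul, hmul, ← Submonoid.coe_mul, ← Submonoid.coe_mul, ← map_mul,
        ← map_mul, mul_inv_rev, mul_inv_cancel_left])
  refine ⟨c.re, fun x => ?_⟩
  have h1 : inner ℂ x (S x) = c * (‖x‖ : ℂ) ^ 2 := by
    rw [hc, inner_smul_right, inner_self_eq_norm_sq_to_K]; rfl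
  have h2 : (inner ℂ x (S x)).re =
      ∑ s, ‖K.starProjection (P (canonicalUnitary α s) x)‖ ^ 2 := by
    rw [hS, inner_sum, Complex.re_sum]
    refine Finset.sum_congr rfl fun s _ => ?_
    rw [← star_canonicalUnitary, map_star, ContinuousLinearMap.star_eq_adjoint,
      ContinuousLinearMap.adjoint_inner_right, ← inner_conj_symm, Complex.conj_re]
    exact K.re_inner_starProjection_eq_normSq _
  rw [← h2, h1]
  rw [← Complex.ofReal_pow, Complex.re_mul_ofReal]

/-- An irreducible representation of the crossed product by a finite group has a nonzero closed
subspace on which `A` acts irreducibly. Passing from an `A`-invariant subspace to a smaller one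
lowers the scalar of `exists_sum_norm_sq_starProjection` by at least `1`, so the descent stops. -/
theorem exists_isIrreducibleRep_subRep {P : CrossedProduct α →⋆ₐ[ℂ] (H →L[ℂ] H)}
    (hP : IsIrreducibleRep P) :
    ∃ (K : Submodule ℂ H) (_ : CompleteSpace K) (hK : ∀ a, ∀ x ∈ K, P.comp (embed α) a x ∈ K),
      IsIrreducibleRep (subRep (P.comp (embed α)) K hK) := by
  have := hP.1
  suffices key : ∀ (N : ℕ) (K : Submodule ℂ H) (_ : CompleteSpace K) (c : ℝ), K ≠ ⊥ →
      (∀ a, ∀ x ∈ K, P.comp (embed α) a x ∈ K) →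
      (∀ x, ∑ s, ‖K.starProjection (P (canonicalUnitary α s) x)‖ ^ 2 = c * ‖x‖ ^ 2) → c < N →
      ∃ (K : Submodule ℂ H) (_ : CompleteSpace K) (hK : ∀ a, ∀ x ∈ K, P.comp (embed α) a x ∈ K),
        IsIrreducibleRep (subRep (P.comp (embed α)) K hK) by
    have hinv : ∀ a, ∀ x ∈ (⊤ : Submodule ℂ H), P.comp (embed α) a x ∈ (⊤ : Submodule ℂ H) :=
      fun _ _ _ => trivial
    have hcomp : CompleteSpace (⊤ : Submodule ℂ H) := isClosed_univ.completeSpace_coe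
    obtain ⟨c, hc⟩ := exists_sum_norm_sq_starProjection hP ⊤ hinv
    obtain ⟨N, hN⟩ := exists_nat_gt c
    exact key N ⊤ hcomp c top_ne_bot hinv hc hN
  intro N
  induction N with
  | zero =>
    intro K _ c _ _ hc hlt
    obtain ⟨x, hx⟩ := exists_ne (0 : H)
    have h1 : 0 ≤ c * ‖x‖ ^ 2 := hc x ▸ Finset.sum_nonneg fun s _ => by positivity
    have h2 : c * ‖x‖ ^ 2 < 0 := mul_neg_of_neg_of_pos (by simpa using hlt) (by positivity)
    exact absurd h1 h2.not_ge
  | succ N ih =>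
    intro K _ c hne hK hc hlt
    by_cases hirr : IsIrreducibleRep (subRep (P.comp (embed α)) K hK)
    · exact ⟨K, ‹_›, hK, hirr⟩
    have hnt : Nontrivial K := Submodule.nontrivial_iff_ne_bot.2 hne
    obtain ⟨L', hcl, hinv, hbot, htop⟩ : ∃ L' : Submodule ℂ K, IsClosed (L' : Set K) ∧
        (∀ a, ∀ x ∈ L', subRep (P.comp (embed α)) K hK a x ∈ L') ∧ L' ≠ ⊥ ∧ L' ≠ ⊤ := by
      by_contra! hcon
      exact hirr ⟨hnt, fun L' h1 h2 => or_iff_not_imp_left.2 (hcon L' h1 h2)⟩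
    have : CompleteSpace L' := hcl.completeSpace_coe
    have hKcl : IsClosed (K : Set H) := (completeSpace_coe_iff_isComplete.1 ‹_›).isClosed
    let L : Submodule ℂ H := L'.map K.subtype
    have hLcl : IsClosed (L : Set H) := by
      rw [Submodule.map_coe]
      exact hKcl.isClosedMap_subtype_val _ hcl
    have hLc : CompleteSpace L := hLcl.completeSpace_coe
    have hLK : L ≤ K := Submodule.map_subtype_le K L'
    have hLinv : ∀ a, ∀ x ∈ L, P.comp (embed α) a x ∈ L := by
      rintro a _ ⟨x, hx, rfl⟩
      exact ⟨_, hinv a x hx, rfl⟩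
    have hL0 : L ≠ ⊥ := fun h => hbot (Submodule.map_injective_of_injective K.injective_subtype
      (h.trans (Submodule.map_bot _).symm))
    obtain ⟨z, hz, hz0⟩ := L'ᗮ.ne_bot_iff.1 (mt L'.orthogonal_eq_bot_iff.1 htop)
    have hzL : (z : H) ∈ Lᗮ := (L.mem_orthogonal _).2 <| by
      rintro _ ⟨x, hx, rfl⟩
      exact (L'.mem_orthogonal z).1 hz x hx
    obtain ⟨d, hd⟩ := exists_sum_norm_sq_starProjection hP L hLinv
    refine ih L hLc d hL0 hLinv hd ?_
    have hle : ∀ w, ‖L.starProjection w‖ ^ 2 ≤ ‖K.starProjection w‖ ^ 2 := fun w => by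
      have h : L.starProjection w = L.starProjection (K.starProjection w) :=
        (DFunLike.congr_fun (Submodule.starProjection_comp_starProjection_of_le hLK) w).symm
      rw [h]
      gcongr
      exact L.norm_starProjection_apply_le _
    -- at `z` the term of the unit element gains `‖z‖ ^ 2`, and no other term decreases
    have hone : ‖L.starProjection (P (canonicalUnitary α (1 : G)) z)‖ ^ 2 + ‖(z : H)‖ ^ 2 ≤
        ‖K.starProjection (P (canonicalUnitary α (1 : G)) z)‖ ^ 2 := by
      rw [map_one, OneMemClass.coe_one, map_one, one_apply_eq_self,
        L.starProjection_apply_eq_zero_iff.2 hzL, K.starProjection_eq_self_iff.2 z.2]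
      simp
    have hsum : d * ‖(z : H)‖ ^ 2 + ‖(z : H)‖ ^ 2 ≤ c * ‖(z : H)‖ ^ 2 := by
      rw [← hc, ← hd, ← Finset.add_sum_erase _ _ (Finset.mem_univ (1 : G)),
        ← Finset.add_sum_erase _ _ (Finset.mem_univ (1 : G)), add_right_comm]
      exact add_le_add hone (Finset.sum_le_sum fun s _ => hle _)
    have hzpos : 0 < ‖(z : H)‖ ^ 2 := by
      have : (z : H) ≠ 0 := by simpa using hz0
      positivity
    have hdc : d + 1 ≤ c := le_of_mul_le_mul_right (by linarith) hzpos
    push_cast at hlt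
    linarith

end CrossedProduct

/-! ### Crossed products by cyclic groups -/

theorem cyclicAction_ofAdd_one {A : Type*} [CStarAlgebra A] (σ : A ≃⋆ₐ[ℂ] A) (n : ℕ)
    (hσ : σ ^ n = 1) (a : A) :
    cyclicAction σ n hσ (Multiplicative.ofAdd (1 : ZMod n)) a = σ a := by
  have := cyclicAction_apply σ n hσ 1
  rw [Int.cast_one, zpow_one] at this
  rw [this]

section Cyclic

variable {A : Type*} [CStarAlgebra A] (σ : A ≃⋆ₐ[ℂ] A) (n : ℕ) [NeZero n] (hσ : σ ^ n = 1)

theorem canonicalUnitary_cyclic (z : Multiplicative (ZMod n)) :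
    CrossedProduct.canonicalUnitary (cyclicAction σ n hσ) z =
      cyclicUnitary σ n hσ ^ (Multiplicative.toAdd z).val := by
  rw [cyclicUnitary, ← map_pow, ← ofAdd_nsmul]
  simp

theorem cyclicUnitary_pow : cyclicUnitary σ n hσ ^ n = 1 := by
  rw [cyclicUnitary, ← map_pow, ← ofAdd_nsmul]
  simp

theorem cyclicUnitary_mul_embed (a : A) :
    (cyclicUnitary σ n hσ : CyclicCrossedProduct σ n hσ) * cyclicEmbed σ n hσ a =
      cyclicEmbed σ n hσ (σ a) * cyclicUnitary σ n hσ := by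
  rw [cyclicUnitary, CrossedProduct.canonicalUnitary_mul_embed, cyclicAction_ofAdd_one]

variable {σ n hσ}

theorem cyclic_intertwines_of_generators
    {H : Type*} [NormedAddCommGroup H] [InnerProductSpace ℂ H] [CompleteSpace H]
    {H' : Type*} [NormedAddCommGroup H'] [InnerProductSpace ℂ H'] [CompleteSpace H']
    {P : CyclicCrossedProduct σ n hσ →⋆ₐ[ℂ] (H →L[ℂ] H)}
    {P' : CyclicCrossedProduct σ n hσ →⋆ₐ[ℂ] (H' →L[ℂ] H')} {T : H →L[ℂ] H'}
    (hA : ∀ a x, T (P (cyclicEmbed σ n hσ a) x) = P' (cyclicEmbed σ n hσ a) (T x))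
    (hU : ∀ x, T (P (cyclicUnitary σ n hσ) x) = P' (cyclicUnitary σ n hσ) (T x))
    (b : CyclicCrossedProduct σ n hσ) (x : H) : T (P b x) = P' b (T x) := by
  refine CrossedProduct.intertwines_of_generators hA (fun z x => ?_) b x
  rw [canonicalUnitary_cyclic, SubmonoidClass.coe_pow, map_pow, map_pow]
  generalize (Multiplicative.toAdd z).val = j
  induction j generalizing x with
  | zero => simp
  | succ j ih => rw [pow_succ, pow_succ, mul_apply_eq_comp, mul_apply_eq_comp, ih, hU]

variable (σ n hσ)

/-- The universal property of `A ⋊_σ ℤ/n` in terms of the single unitary `U`. -/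
theorem existsUnique_cyclic_lift {B : Type*} [Ring B] [StarRing B] [Algebra ℂ B]
    (ρ : A →⋆ₐ[ℂ] B) (u : unitary B) (hu : u ^ n = 1)
    (hcov : ∀ a, (u : B) * ρ a = ρ (σ a) * u) :
    ∃! Φ : CyclicCrossedProduct σ n hσ →⋆ₐ[ℂ] B,
      (∀ a, Φ (cyclicEmbed σ n hσ a) = ρ a) ∧ Φ (cyclicUnitary σ n hσ) = u := by
  let V : Multiplicative (ZMod n) →* unitary B := AddMonoidHom.toMultiplicativeLeft
    (ZMod.lift n ⟨zmultiplesHom (Additive (unitary B)) (Additive.ofMul u), by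
      simp [← ofMul_pow, hu]⟩)
  have hVz : ∀ z : ℤ, V (Multiplicative.ofAdd (z : ZMod n)) = u ^ z := fun z => by simp [V]
  have hV : ∀ j : ℕ, V (Multiplicative.ofAdd (j : ZMod n)) = u ^ j := fun j => by
    simpa using hVz j
  have hα : ∀ j : ℕ, cyclicAction σ n hσ (Multiplicative.ofAdd (j : ZMod n)) = σ ^ j := fun j => by
    have := cyclicAction_apply σ n hσ j
    simpa using this
  have hz : ∀ z : Multiplicative (ZMod n), ∃ j : ℕ, z = Multiplicative.ofAdd (j : ZMod n) :=
    fun z => ⟨(Multiplicative.toAdd z).val, by simp⟩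
  have hpow : ∀ (j : ℕ) (a : A),
      ((u ^ j : unitary B) : B) * ρ a = ρ ((σ ^ j) a) * (u ^ j : unitary B) :=
    fun j a => by
      induction j generalizing a with
      | zero => simp
      | succ j ih =>
        rw [pow_succ, Submonoid.coe_mul, mul_assoc, hcov, ← mul_assoc, ih, mul_assoc, pow_succ]
        rfl
  obtain ⟨Φ, ⟨h1, h2⟩, -⟩ := CrossedProduct.existsUnique_lift (cyclicAction σ n hσ) ρ V
    fun z a => by
      obtain ⟨j, rfl⟩ := hz z
      rw [hV, hα, hpow, mul_assoc, Unitary.mul_star_self_of_mem (u ^ j).2, mul_one]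
  refine ⟨Φ, ⟨h1, ?_⟩, ?_⟩
  · rw [cyclicUnitary, h2]
    have := hV 1
    rw [Nat.cast_one, pow_one] at this
    rw [this]
  · rintro Ψ ⟨h3, h4⟩
    ext x
    rw [CrossedProduct.eq_sum _ x]
    simp only [map_sum, map_mul, h1, h3]
    refine Finset.sum_congr rfl fun z _ => ?_
    rw [h2, canonicalUnitary_cyclic, SubmonoidClass.coe_pow, map_pow, h4]
    have := hV (Multiplicative.toAdd z).val
    simp only [ZMod.natCast_val, ZMod.cast_id', id_eq, ofAdd_toAdd] at this
    rw [this, SubmonoidClass.coe_pow]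

end Cyclic

/-! ### Twists of a representation by powers of an automorphism -/

section Twist

variable {A : Type*} [CStarAlgebra A] {σ : A ≃⋆ₐ[ℂ] A}
  {J : Type*} [NormedAddCommGroup J] [InnerProductSpace ℂ J] [CompleteSpace J]
  {J' : Type*} [NormedAddCommGroup J'] [InnerProductSpace ℂ J'] [CompleteSpace J']
  {π₁ : A →⋆ₐ[ℂ] (J →L[ℂ] J)} {π₂ : A →⋆ₐ[ℂ] (J' →L[ℂ] J')}

theorem twistRep_zero : twistRep σ π₁ 0 = π₁ := by ext; simp

theorem twistRep_twistRep (i j : ℕ) :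
    twistRep σ (twistRep σ π₁ i) j = twistRep σ π₁ (i + j) := by
  ext a x
  rw [twistRep_apply, twistRep_apply, twistRep_apply, pow_add]
  rfl

theorem UnitarilyEquivalent.twistRep (h : UnitarilyEquivalent π₁ π₂) (i : ℕ) :
    UnitarilyEquivalent (twistRep σ π₁ i) (twistRep σ π₂ i) :=
  h.comp _

theorem UnitarilyEquivalent.of_twistRep {i : ℕ}
    (h : UnitarilyEquivalent (_root_.twistRep σ π₁ i) (_root_.twistRep σ π₂ i)) :
    UnitarilyEquivalent π₁ π₂ := by
  obtain ⟨W, hW⟩ := h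
  refine ⟨W, fun a x => ?_⟩
  have := hW ((σ ^ i).symm a) x
  simpa using this

theorem IsIrreducibleRep.twistRep (h : IsIrreducibleRep π₁) (i : ℕ) :
    IsIrreducibleRep (twistRep σ π₁ i) :=
  ⟨h.1, fun K hK hinv => h.2 K hK fun a x hx => by
    have := hinv ((σ ^ i).symm a) x hx
    simpa using this⟩

theorem twistRep_inequivalent {m : ℕ}
    (h : ∀ i, 0 < i → i < m → ¬ UnitarilyEquivalent π₁ (twistRep σ π₁ i)) {i j : Fin m}
    (hij : i ≠ j) : ¬ UnitarilyEquivalent (twistRep σ π₁ i) (twistRep σ π₁ j) := by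
  have key : ∀ i j : Fin m, i < j →
      ¬ UnitarilyEquivalent (twistRep σ π₁ i) (twistRep σ π₁ j) := fun i j hlt hE => by
    have hlt' : (i : ℕ) < j := hlt
    refine h (j - i) (by omega) (by omega) (UnitarilyEquivalent.of_twistRep (σ := σ) (i := i) ?_)
    rwa [twistRep_twistRep, Nat.sub_add_cancel hlt'.le]
  rcases lt_or_gt_of_ne hij with hlt | hlt
  · exact key i j hlt
  · exact fun hE => key j i hlt hE.symm

end Twist

/-! ### The commutant of a direct sum of irreducible representations -/

/-- An operator commuting with a direct sum of irreducible representations on the same space has a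
matrix of scalars, provided that any two of the representations are equal or inequivalent. -/
theorem exists_scalar_matrix_of_commute {B : Type*} [Ring B] [StarRing B] [Algebra ℂ B]
    {J : Type*} [NormedAddCommGroup J] [InnerProductSpace ℂ J] [CompleteSpace J]
    {ι : Type*} [Fintype ι] {ρ : ι → B →⋆ₐ[ℂ] (J →L[ℂ] J)}
    (hirr : ∀ i, IsIrreducibleRep (ρ i))
    (hρ : ∀ i j, ρ i = ρ j ∨ ¬ UnitarilyEquivalent (ρ i) (ρ j))
    {T : PiLp 2 (fun _ : ι => J) →L[ℂ] PiLp 2 (fun _ : ι => J)}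
    (hT : ∀ b ξ, T (directSumRep ρ b ξ) = directSumRep ρ b (T ξ)) :
    ∃ c : ι → ι → ℂ, (∀ i j, ρ i ≠ ρ j → c i j = 0) ∧ ∀ ξ i, T ξ i = ∑ j, c i j • ξ j := by
  classical
  -- the entries `E i j` of the matrix of `T` intertwine `ρ j` with `ρ i`
  let inc : ∀ j : ι, J →L[ℂ] PiLp 2 (fun _ : ι => J) := fun j =>
    ((PiLp.continuousLinearEquiv 2 ℂ (fun _ : ι => J)).symm :
      (ι → J) →L[ℂ] PiLp 2 (fun _ : ι => J)) ∘L ContinuousLinearMap.single ℂ (fun _ : ι => J) j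
  have hinc : ∀ j x i, inc j x i = if i = j then x else 0 := fun j x i => by
    change (Pi.single j x : ι → J) i = _
    rw [Pi.single_apply]
  let E : ι → ι → J →L[ℂ] J := fun i j => PiLp.proj 2 (fun _ : ι => J) i ∘L T ∘L inc j
  have hE : ∀ i j x, E i j x = T (inc j x) i := fun _ _ _ => rfl
  have hint : ∀ i j b x, E i j (ρ j b x) = ρ i b (E i j x) := fun i j b x => by
    have h : inc j (ρ j b x) = directSumRep ρ b (inc j x) := by
      ext l
      change _ = ρ l b (inc j x l)
      rw [hinc, hinc]
      by_cases hl : l = j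
      · subst hl; simp
      · simp [hl]
    rw [hE, hE, h, hT]
    rfl
  have hex : ∀ i j, ∃ c : ℂ, (ρ i ≠ ρ j → c = 0) ∧ ∀ x, E i j x = c • x := fun i j => by
    rcases hρ i j with h | h
    · obtain ⟨c, hc⟩ := (hirr j).exists_eq_smul (T := E i j) fun b x => by rw [hint, h]
      exact ⟨c, fun hne => absurd h hne, hc⟩
    · refine ⟨0, fun _ => rfl, fun x => ?_⟩
      by_contra hx
      refine h ((hirr j).unitarilyEquivalent_of_intertwiner (hirr i) (hint i j) ?_).symm
      rintro h0
      rw [h0] at hx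
      simp at hx
  choose c hc0 hc using hex
  refine ⟨c, hc0, fun ξ i => ?_⟩
  have hξ : ξ = ∑ j, inc j (ξ j) := by
    ext l
    rw [← PiLp.proj_apply 2 (𝕜 := ℂ) (fun _ : ι => J) l (∑ j, inc j (ξ j)), map_sum]
    simp [hinc]
  conv_lhs => rw [hξ, map_sum, ← PiLp.proj_apply 2 (𝕜 := ℂ) (fun _ : ι => J) i, map_sum]
  exact Finset.sum_congr rfl fun j _ => hc i j (ξ j)

/-! ### The cyclic shift -/

section CyclicShift

variable {J : Type*} [NormedAddCommGroup J] [InnerProductSpace ℂ J] {m : ℕ}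

theorem cyclicShift_pow_apply (V : J →L[ℂ] J) {j : ℕ} (hj : j ≤ m)
    (ξ : PiLp 2 (fun _ : Fin m => J)) (i : Fin m) :
    (cyclicShift m V ^ j) ξ i =
      if h : (i : ℕ) + j < m then ξ ⟨i + j, h⟩ else V (ξ ⟨i + j - m, by omega⟩) := by
  induction j generalizing i with
  | zero => simp
  | succ j ih =>
    rw [pow_succ', mul_apply_eq_comp, cyclicShift_apply]
    by_cases hi : (i : ℕ) + 1 < m
    · simp only [hi, dif_pos]
      rw [ih (by omega)]
      have h1 : (i : ℕ) + 1 + j = i + (j + 1) := by omega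
      simp only [h1]
    · have h1 : ¬ (i : ℕ) + (j + 1) < m := by omega
      have h2 : 0 + j < m := by omega
      have h3 : (i : ℕ) + (j + 1) - m = 0 + j := by omega
      simp only [hi, h1, dif_neg, not_false_eq_true, h3]
      rw [ih (by omega), dif_pos h2]

theorem cyclicShift_pow_mul_apply (V : J →L[ℂ] J) (k : ℕ)
    (ξ : PiLp 2 (fun _ : Fin m => J)) (i : Fin m) :
    (cyclicShift m V ^ (k * m)) ξ i = (V ^ k) (ξ i) := by
  induction k generalizing ξ with
  | zero => simp
  | succ k ih =>
    rw [add_mul, one_mul, pow_add, mul_apply_eq_comp, ih, cyclicShift_pow_apply V le_rfl,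
      dif_neg (by omega), pow_succ, mul_apply_eq_comp]
    simp

theorem cyclicShift_pow_eq_one {V : J →L[ℂ] J} {k : ℕ} (hV : V ^ k = 1) :
    cyclicShift m V ^ (k * m) = 1 := by
  ext ξ i
  rw [cyclicShift_pow_mul_apply, hV]
  rfl

variable [CompleteSpace J]

theorem norm_cyclicShift_apply (V : unitary (J →L[ℂ] J)) (ξ : PiLp 2 (fun _ : Fin m => J)) :
    ‖cyclicShift m (V : J →L[ℂ] J) ξ‖ = ‖ξ‖ := by
  rw [← sq_eq_sq₀ (norm_nonneg _) (norm_nonneg _), PiLp.norm_sq_eq_of_L2, PiLp.norm_sq_eq_of_L2]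
  cases m with
  | zero => simp
  | succ m =>
    rw [Fin.sum_univ_castSucc, Fin.sum_univ_succ, add_comm]
    congr 1
    · rw [cyclicShift_apply, dif_neg (by simp), Unitary.norm_map]
      rfl
    · refine Finset.sum_congr rfl fun i _ => ?_
      rw [cyclicShift_apply, dif_pos (by simp)]
      rfl

theorem cyclicShift_mem_unitary {V : unitary (J →L[ℂ] J)} {k : ℕ} (hV : V ^ k = 1)
    (hkm : k * m ≠ 0) :
    cyclicShift m (V : J →L[ℂ] J) ∈
      unitary (PiLp 2 (fun _ : Fin m => J) →L[ℂ] PiLp 2 (fun _ : Fin m => J)) := by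
  have hpow : cyclicShift m (V : J →L[ℂ] J) ^ (k * m) = 1 :=
    cyclicShift_pow_eq_one (by rw [← SubmonoidClass.coe_pow, hV]; rfl)
  -- an isometry of finite order is invertible, hence unitary
  exact (IsUnit.of_pow_eq_one hpow hkm).mem_unitary_of_star_mul_self
    ((ContinuousLinearMap.norm_map_iff_adjoint_comp_self _).1 (norm_cyclicShift_apply V))

end CyclicShift

/-! ### Representations of cyclic form -/

namespace IsCyclicDatum

variable {A : Type*} [CStarAlgebra A] {σ : A ≃⋆ₐ[ℂ] A} {k m n : ℕ}
  {J : Type*} [NormedAddCommGroup J] [InnerProductSpace ℂ J] [CompleteSpace J]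
  {π₁ : A →⋆ₐ[ℂ] (J →L[ℂ] J)} {V : unitary (J →L[ℂ] J)}

theorem mul_eq (h : IsCyclicDatum σ k m π₁ V) (a : A) :
    (V : J →L[ℂ] J) * π₁ a = π₁ ((σ ^ m) a) * V := by
  rw [← twistRep_apply, ← h.implements, mul_assoc, Unitary.coe_star_mul_self, mul_one]

theorem apply_apply (h : IsCyclicDatum σ k m π₁ V) (a : A) (x : J) :
    (V : J →L[ℂ] J) (π₁ a x) = π₁ ((σ ^ m) a) ((V : J →L[ℂ] J) x) :=
  DFunLike.congr_fun (h.mul_eq a) x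

theorem existsUnique_isCyclicForm [NeZero n] {hσ : σ ^ n = 1} (hkm : k * m = n)
    (h : IsCyclicDatum σ k m π₁ V) :
    ∃! Q : CyclicCrossedProduct σ n hσ →⋆ₐ[ℂ]
      (PiLp 2 (fun _ : Fin m => J) →L[ℂ] PiLp 2 (fun _ : Fin m => J)),
      IsCyclicForm σ n hσ m π₁ V Q := by
  have hn : k * m ≠ 0 := hkm ▸ NeZero.ne n
  refine existsUnique_cyclic_lift σ n hσ (directSumRep fun i : Fin m => twistRep σ π₁ i)
    ⟨cyclicShift m (V : J →L[ℂ] J), cyclicShift_mem_unitary h.pow_eq_one hn⟩ ?_ fun a => ?_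
  · refine Subtype.ext ?_
    rw [SubmonoidClass.coe_pow, ← hkm]
    exact cyclicShift_pow_eq_one (by rw [← SubmonoidClass.coe_pow, h.pow_eq_one]; rfl)
  · ext ξ i
    change cyclicShift m (V : J →L[ℂ] J) (directSumRep _ a ξ) i =
      π₁ ((σ ^ (i : ℕ)) (σ a)) (cyclicShift m (V : J →L[ℂ] J) ξ i)
    have hσi : (σ ^ (i : ℕ)) (σ a) = (σ ^ ((i : ℕ) + 1)) a := by rw [pow_succ]; rfl
    rw [cyclicShift_apply, cyclicShift_apply, hσi]
    by_cases hi : (i : ℕ) + 1 < m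
    · rw [dif_pos hi, dif_pos hi]
      rfl
    · rw [dif_neg hi, dif_neg hi, show (i : ℕ) + 1 = m by omega, ← h.apply_apply]
      change (V : J →L[ℂ] J) (π₁ ((σ ^ 0) a) _) = _
      rw [pow_zero]
      rfl

/-- The commutant of a representation of cyclic form is scalar: its elements are diagonal since the
twists of `π₁` are inequivalent, and the shift forces the diagonal entries to agree. -/
theorem isIrreducibleRep_of_isCyclicForm [NeZero n] {hσ : σ ^ n = 1} (hkm : k * m = n)
    (h : IsCyclicDatum σ k m π₁ V)
    {Q : CyclicCrossedProduct σ n hσ →⋆ₐ[ℂ]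
      (PiLp 2 (fun _ : Fin m => J) →L[ℂ] PiLp 2 (fun _ : Fin m => J))}
    (hQ : IsCyclicForm σ n hσ m π₁ V Q) : IsIrreducibleRep Q := by
  have hm : 0 < m := Nat.pos_of_ne_zero fun h0 => NeZero.ne n (by rw [← hkm, h0, mul_zero])
  have : Nontrivial J := h.irreducible.1
  have : Nonempty (Fin m) := ⟨⟨0, hm⟩⟩
  have : Nontrivial (PiLp 2 (fun _ : Fin m => J)) :=
    (WithLp.equiv 2 (Fin m → J)).nontrivial
  refine isIrreducibleRep_of_commutant Q fun T hT => ?_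
  obtain ⟨c, hc0, hc⟩ := exists_scalar_matrix_of_commute (ρ := fun i : Fin m => twistRep σ π₁ i)
    (T := T) (fun i => h.irreducible.twistRep i)
    (fun i j => (eq_or_ne i j).imp (fun hij => by rw [hij])
      fun hij => twistRep_inequivalent h.inequivalent hij)
    fun a ξ => by rw [← hQ.1, hT]
  have hne : ∀ i j : Fin m, i ≠ j → c i j = 0 := fun i j hij => hc0 i j fun heq =>
    twistRep_inequivalent h.inequivalent hij (heq ▸ UnitarilyEquivalent.refl _)
  have hdiag : ∀ ξ i, T ξ i = c i i • ξ i := fun ξ i => by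
    rw [hc, Finset.sum_eq_single i (fun j _ hj => by rw [hne i j hj.symm, zero_smul])
      fun hi => absurd (Finset.mem_univ i) hi]
  obtain ⟨x, hx⟩ := exists_ne (0 : J)
  -- compare the `i`-th components of `T U ξ` and `U T ξ` for a constant `ξ`
  have hstep : ∀ (i : ℕ) (hi : i + 1 < m),
      c ⟨i, by omega⟩ ⟨i, by omega⟩ = c ⟨i + 1, hi⟩ ⟨i + 1, hi⟩ := fun i hi => by
    have h1 := congrArg (fun η : PiLp 2 (fun _ : Fin m => J) => η ⟨i, by omega⟩)
      (hT (cyclicUnitary σ n hσ) (WithLp.toLp 2 fun _ => x))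
    simp only [hQ.2, hdiag, cyclicShift_apply, dif_pos hi] at h1
    exact smul_left_injective ℂ hx h1
  have hconst : ∀ (i : ℕ) (hi : i < m), c ⟨i, hi⟩ ⟨i, hi⟩ = c ⟨0, hm⟩ ⟨0, hm⟩ := fun i hi => by
    induction i with
    | zero => rfl
    | succ i ih => rw [← hstep i hi, ih]
  refine ⟨c ⟨0, hm⟩ ⟨0, hm⟩, fun ξ => ?_⟩
  ext i
  rw [hdiag, hconst i i.2]
  rfl

theorem existsUnique_minimal [NeZero k] {hσ : (σ ^ m) ^ k = 1} (h : IsCyclicDatum σ k m π₁ V) :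
    ∃! ψ : CyclicCrossedProduct (σ ^ m) k hσ →⋆ₐ[ℂ] (J →L[ℂ] J),
      (∀ a, ψ (cyclicEmbed (σ ^ m) k hσ a) = π₁ a) ∧ ψ (cyclicUnitary (σ ^ m) k hσ) = V :=
  existsUnique_cyclic_lift (σ ^ m) k hσ π₁ V h.pow_eq_one h.mul_eq

end IsCyclicDatum

theorem isMinimalRep_of_comp_embed {A : Type*} [CStarAlgebra A] {G : Type*} [Group G] [Fintype G]
    [DecidableEq G] {α : G →* (A ≃⋆ₐ[ℂ] A)}
    {H : Type*} [NormedAddCommGroup H] [InnerProductSpace ℂ H] [CompleteSpace H]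
    {P : CrossedProduct α →⋆ₐ[ℂ] (H →L[ℂ] H)}
    (h : IsIrreducibleRep (P.comp (CrossedProduct.embed α))) : IsMinimalRep P :=
  ⟨⟨h.1, fun K hK hinv => h.2 K hK fun _ x hx => hinv _ x hx⟩, h⟩

/-! ### Unitaries of finite order -/

section UnitaryOfFiniteOrder

variable {J : Type*} [NormedAddCommGroup J] [InnerProductSpace ℂ J] [CompleteSpace J]
  {V : unitary (J →L[ℂ] J)} {k : ℕ}

theorem toLinearMap_pow_eq_one (hV : V ^ k = 1) :
    ((V : J →L[ℂ] J) : Module.End ℂ J) ^ k = 1 := by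
  have h : (V : J →L[ℂ] J) ^ k = 1 := by rw [← SubmonoidClass.coe_pow, hV]; rfl
  rw [← ContinuousLinearMap.toLinearMap_pow, h]
  rfl

theorem norm_eq_one_of_mem_eigenspace {μ : ℂ} {x : J}
    (hx : x ∈ Module.End.eigenspace ((V : J →L[ℂ] J) : Module.End ℂ J) μ) (hx0 : x ≠ 0) :
    ‖μ‖ = 1 := by
  have h1 : (V : J →L[ℂ] J) x = μ • x := Module.End.mem_eigenspace_iff.1 hx
  have h2 := Unitary.norm_map V x
  rw [h1, norm_smul] at h2
  exact mul_right_cancel₀ (norm_ne_zero_iff.2 hx0) (by rw [h2, one_mul])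

theorem orthogonalFamily_eigenspace_unitary (V : unitary (J →L[ℂ] J)) :
    OrthogonalFamily ℂ
      (fun μ : ℂ => Module.End.eigenspace ((V : J →L[ℂ] J) : Module.End ℂ J) μ)
      fun μ => (Module.End.eigenspace ((V : J →L[ℂ] J) : Module.End ℂ J) μ).subtypeₗᵢ := by
  rintro μ ν hμν ⟨x, hx⟩ ⟨y, hy⟩
  change inner ℂ x y = 0
  by_cases hx0 : x = 0
  · rw [hx0, inner_zero_left]
  have hμ := norm_eq_one_of_mem_eigenspace hx hx0
  have h1 : (V : J →L[ℂ] J) x = μ • x := Module.End.mem_eigenspace_iff.1 hx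
  have h2 : (V : J →L[ℂ] J) y = ν • y := Module.End.mem_eigenspace_iff.1 hy
  have h3 := Unitary.inner_map_map V x y
  rw [h1, h2, inner_smul_left, inner_smul_right, ← mul_assoc] at h3
  by_contra hne
  have h4 : (starRingEnd ℂ) μ * ν = 1 := mul_right_cancel₀ hne (by rw [h3, one_mul])
  have h5 : μ * (starRingEnd ℂ) μ = 1 := by
    rw [Complex.mul_conj, Complex.normSq_eq_norm_sq, hμ]
    simp
  refine hμν ?_
  calc μ = μ * ((starRingEnd ℂ) μ * ν) := by rw [h4, mul_one]
    _ = ν := by rw [← mul_assoc, h5, one_mul]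

theorem mem_spectrum_iff_eigenspace_ne_bot [NeZero k] (hV : V ^ k = 1) (μ : ℂ) :
    μ ∈ spectrum ℂ (V : J →L[ℂ] J) ↔
      Module.End.eigenspace ((V : J →L[ℂ] J) : Module.End ℂ J) μ ≠ ⊥ := by
  have hker : ∀ x, (algebraMap ℂ (J →L[ℂ] J) μ - V : J →L[ℂ] J) x = μ • x - (V : J →L[ℂ] J) x :=
    fun x => by simp [Algebra.algebraMap_eq_smul_one]
  rw [spectrum.mem_iff, not_iff_not, ContinuousLinearMap.isUnit_iff_bijective]
  constructor
  · rintro ⟨hinj, -⟩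
    rw [eq_bot_iff]
    intro x hx
    have h1 : (V : J →L[ℂ] J) x = μ • x := Module.End.mem_eigenspace_iff.1 hx
    exact hinj (by rw [hker, h1, sub_self, map_zero])
  · intro hbot
    refine ⟨(injective_iff_map_eq_zero _).2 fun x hx => ?_, ?_⟩
    · rw [hker, sub_eq_zero] at hx
      have : x ∈ Module.End.eigenspace ((V : J →L[ℂ] J) : Module.End ℂ J) μ :=
        Module.End.mem_eigenspace_iff.2 hx.symm
      rwa [hbot] at this
    · -- every eigenspace for an eigenvalue other than `μ` lies in the range
      have hle : ⨆ ν : ℂ, Module.End.eigenspace ((V : J →L[ℂ] J) : Module.End ℂ J) ν ≤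
          LinearMap.range ((algebraMap ℂ (J →L[ℂ] J) μ - V : J →L[ℂ] J) : J →ₗ[ℂ] J) := by
        refine iSup_le fun ν => ?_
        by_cases hν : ν = μ
        · rw [hν, hbot]
          exact bot_le
        · intro y hy
          have h1 : (V : J →L[ℂ] J) y = ν • y := Module.End.mem_eigenspace_iff.1 hy
          refine ⟨(μ - ν)⁻¹ • y, ?_⟩
          change (algebraMap ℂ (J →L[ℂ] J) μ - V : J →L[ℂ] J) ((μ - ν)⁻¹ • y) = y
          rw [map_smul, hker, h1, ← sub_smul,
            inv_smul_smul₀ (sub_ne_zero.2 (Ne.symm hν))]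
      rw [iSup_eigenspace_eq_top_of_pow_eq_one (toLinearMap_pow_eq_one hV)] at hle
      exact fun y => hle (Submodule.mem_top (x := y))

theorem finite_spectrum_of_pow_eq_one [NeZero k] (hV : V ^ k = 1) :
    (spectrum ℂ (V : J →L[ℂ] J)).Finite := by
  refine (Polynomial.nthRootsFinset k (1 : ℂ)).finite_toSet.subset fun μ hμ => ?_
  rw [mem_spectrum_iff_eigenspace_ne_bot hV, Submodule.ne_bot_iff] at hμ
  obtain ⟨x, hx, hx0⟩ := hμ
  exact (Polynomial.mem_nthRootsFinset (NeZero.pos k) _).2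
    (pow_eq_one_of_mem_eigenspace (toLinearMap_pow_eq_one hV) hx hx0)

instance completeSpace_eigenspace (T : J →L[ℂ] J) (μ : ℂ) :
    CompleteSpace (Module.End.eigenspace (T : Module.End ℂ J) μ) := by
  have : (Module.End.eigenspace (T : Module.End ℂ J) μ : Set J) = {x | T x = μ • x} := by
    ext x
    exact Module.End.mem_eigenspace_iff
  refine completeSpace_coe_iff_isComplete.2 (IsClosed.isComplete ?_)
  rw [this]
  exact isClosed_eq T.continuous (continuous_const_smul μ)

end UnitaryOfFiniteOrder

/-- A representation is the direct sum of its restrictions to mutually orthogonal closed invariant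
subspaces that span the space. -/
theorem unitarilyEquivalent_directSumRep_subRep {B : Type*} [Ring B] [StarRing B] [Algebra ℂ B]
    {H : Type*} [NormedAddCommGroup H] [InnerProductSpace ℂ H] [CompleteSpace H]
    (ρ : B →⋆ₐ[ℂ] (H →L[ℂ] H)) {ι : Type*} [Fintype ι] (K : ι → Submodule ℂ H)
    [∀ j, CompleteSpace (K j)] (hK : ∀ j b, ∀ x ∈ K j, ρ b x ∈ K j)
    (horth : OrthogonalFamily ℂ (fun j => K j) fun j => (K j).subtypeₗᵢ) (htop : ⨆ j, K j = ⊤) :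
    UnitarilyEquivalent ρ (directSumRep fun j => subRep ρ (K j) (hK j)) := by
  classical
  have hint : DirectSum.IsInternal K :=
    DirectSum.isInternal_submodule_of_iSupIndep_of_iSup_eq_top horth.independent htop
  obtain ⟨W, hW⟩ : ∃ W : H ≃ₗᵢ[ℂ] PiLp 2 fun j => K j, ∀ w, W.symm w = ∑ j, (w j : H) :=
    ⟨_, hint.isometryL2OfOrthogonalFamily_symm_apply horth⟩
  refine ⟨W, fun b x => ?_⟩
  rw [← W.symm.injective.eq_iff, W.symm_apply_apply, hW]
  conv_lhs => rw [← W.symm_apply_apply x, hW, map_sum]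
  rfl

/-! ### Restriction to the fixed-point algebra -/

section FixedPoint

variable {A : Type*} [CStarAlgebra A] {σ : A ≃⋆ₐ[ℂ] A} {k m : ℕ}
  {J : Type*} [NormedAddCommGroup J] [InnerProductSpace ℂ J] [CompleteSpace J]
  {π₁ : A →⋆ₐ[ℂ] (J →L[ℂ] J)} {V : unitary (J →L[ℂ] J)}

/-- For inequivalent twists and linearly independent `xⱼ`, the orbit of the vector with the
components `xⱼ` in each of the spaces of `⊕ᵢ ⊕ⱼ π₁ ∘ σⁱ` is total: the projection onto its
orthogonal complement has a scalar matrix that annihilates the `xⱼ`. -/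
theorem eq_zero_of_sum_inner_twistRep (hirr : IsIrreducibleRep π₁)
    (hineq : ∀ i, 0 < i → i < m → ¬ UnitarilyEquivalent π₁ (twistRep σ π₁ i)) (hm : 0 < m)
    {κ : Type*} [Fintype κ] {x y : κ → J} (hx : LinearIndependent ℂ x)
    (h : ∀ a, ∑ i : Fin m, ∑ j, inner ℂ (y j) (π₁ ((σ ^ (i : ℕ)) a) (x j)) = 0) : y = 0 := by
  classical
  let R := directSumRep fun p : Fin m × κ => twistRep σ π₁ p.1
  let X : PiLp 2 (fun _ : Fin m × κ => J) := WithLp.toLp 2 fun p => x p.2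
  let Y : PiLp 2 (fun _ : Fin m × κ => J) := WithLp.toLp 2 fun p => y p.2
  obtain ⟨L, hLdef⟩ : ∃ L : Submodule ℂ (PiLp 2 (fun _ : Fin m × κ => J)),
      L = (Submodule.span ℂ (Set.range fun a => R a X))ᗮ := ⟨_, rfl⟩
  have hLc : CompleteSpace L := by
    rw [hLdef]
    exact (Submodule.isClosed_orthogonal _).completeSpace_coe
  have hL : ∀ z, z ∈ L ↔ ∀ a, inner ℂ z (R a X) = 0 := fun z => by
    rw [hLdef, Submodule.mem_orthogonal']
    refine ⟨fun hz a => hz _ (Submodule.subset_span ⟨a, rfl⟩), fun hz u hu => ?_⟩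
    induction hu using Submodule.span_induction with
    | mem u hu => obtain ⟨a, rfl⟩ := hu; exact hz a
    | zero => exact inner_zero_right _
    | add u v _ _ hu hv => rw [inner_add_right, hu, hv, add_zero]
    | smul c u _ hu => rw [inner_smul_right, hu, mul_zero]
  have hinv : ∀ b, ∀ z ∈ L, R b z ∈ L := fun b z hz => (hL _).2 fun a => by
    rw [← ContinuousLinearMap.adjoint_inner_right, ← ContinuousLinearMap.star_eq_adjoint,
      ← map_star, ← mul_apply_eq_comp, ← map_mul]
    exact (hL z).1 hz _
  have hYL : Y ∈ L := (hL Y).2 fun a => by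
    rw [PiLp.inner_apply, Fintype.sum_prod_type]
    exact h a
  obtain ⟨c, hc0, hc⟩ := exists_scalar_matrix_of_commute
    (ρ := fun p : Fin m × κ => twistRep σ π₁ p.1) (T := L.starProjection)
    (fun p => hirr.twistRep p.1)
    (fun p q => (eq_or_ne p.1 q.1).imp (fun hpq => by rw [hpq])
      fun hpq => twistRep_inequivalent hineq hpq)
    (starProjection_commutes R L hinv)
  have hoff : ∀ (i i' : Fin m) (j j' : κ), i ≠ i' → c (i, j) (i', j') = 0 := fun i i' j j' hii =>
    hc0 _ _ fun heq => twistRep_inequivalent hineq hii (heq ▸ UnitarilyEquivalent.refl _)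
  have hsum : ∀ z (i : Fin m) (j : κ),
      L.starProjection z (i, j) = ∑ j', c (i, j) (i, j') • z (i, j') := fun z i j => by
    rw [hc, Fintype.sum_prod_type, Finset.sum_eq_single i]
    · exact fun i' _ hi' => Finset.sum_eq_zero fun j' _ => by
        rw [hoff i i' j j' hi'.symm, zero_smul]
    · exact fun hi => absurd (Finset.mem_univ i) hi
  have hX : L.starProjection X = 0 := by
    refine L.starProjection_apply_eq_zero_iff.2 ?_
    rw [hLdef]
    refine Submodule.le_orthogonal_orthogonal _ (Submodule.subset_span ⟨1, ?_⟩)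
    change R 1 X = X
    rw [map_one]
    rfl
  have hczero : ∀ (i : Fin m) (j j' : κ), c (i, j) (i, j') = 0 := fun i j =>
    Fintype.linearIndependent_iff.1 hx _ ((hsum X i j).symm.trans (by rw [hX]; rfl))
  funext j
  have hYj : L.starProjection Y (⟨0, hm⟩, j) = y j := by
    rw [L.starProjection_eq_self_iff.2 hYL]
  rw [← hYj, hsum]
  exact Finset.sum_eq_zero fun j' _ => by rw [hczero, zero_smul]

theorem sum_range_mul_of_periodic {M : Type*} [AddCommMonoid M] {f : ℕ → M}
    (hf : ∀ s, f (s + m) = f s) (k : ℕ) :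
    ∑ s ∈ Finset.range (k * m), f s = k • ∑ s ∈ Finset.range m, f s := by
  have hf' : ∀ k s, f (k * m + s) = f s := fun k s => by
    induction k with
    | zero => simp
    | succ k ih => rw [← ih, ← hf (k * m + s), add_mul, one_mul, add_right_comm]
  induction k with
  | zero => simp
  | succ k ih =>
    rw [add_mul, one_mul, Finset.sum_range_add, ih, succ_nsmul]
    simp only [hf']

theorem pow_apply_of_mem_fixedPointAlgebra {a : A} (ha : a ∈ fixedPointAlgebra σ) (i : ℕ) :
    (σ ^ i) a = a := by
  induction i with
  | zero => simp
  | succ i ih =>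
    rw [pow_succ]
    change (σ ^ i) (σ a) = a
    rw [show σ a = a from ha, ih]

theorem sum_pow_apply_mem_fixedPointAlgebra {n : ℕ} (hσ : σ ^ n = 1) (a : A) :
    ∑ s ∈ Finset.range n, (σ ^ s) a ∈ fixedPointAlgebra σ := by
  change σ _ = _
  have h1 : ∀ s, σ ((σ ^ s) a) = (σ ^ (s + 1)) a := fun s => by rw [pow_succ']; rfl
  have h2 := Finset.sum_range_succ' (fun s => (σ ^ s) a) n
  rw [Finset.sum_range_succ, hσ] at h2
  rw [map_sum]
  simp only [h1]
  simpa using h2.symm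

/-- The analogue of `eq_zero_of_sum_inner_twistRep` for the fixed-point algebra and eigenvectors of
`V`. Test against the averages `∑ₛ σˢ(a)`: for eigenvectors, `⟪y, π₁(σˢ a) x⟫` has period `m`
in `s`, because `V` implements `σᵐ`. -/
theorem IsCyclicDatum.eq_zero_of_sum_inner_fixedPointAlgebra (hσ : σ ^ (k * m) = 1)
    (hk : 0 < k) (hm : 0 < m) (hd : IsCyclicDatum σ k m π₁ V) {κ : Type*} [Fintype κ]
    {x y : κ → J} {μ : κ → ℂ} (hx : LinearIndependent ℂ x)
    (hxV : ∀ j, x j ∈ Module.End.eigenspace ((V : J →L[ℂ] J) : Module.End ℂ J) (μ j))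
    (hyV : ∀ j, y j ∈ Module.End.eigenspace ((V : J →L[ℂ] J) : Module.End ℂ J) (μ j))
    (h : ∀ b ∈ fixedPointAlgebra σ, ∑ j, inner ℂ (y j) (π₁ b (x j)) = 0) : y = 0 := by
  refine eq_zero_of_sum_inner_twistRep hd.irreducible hd.inequivalent hm hx fun a => ?_
  have hper : ∀ j b, inner ℂ (y j) (π₁ ((σ ^ m) b) (x j)) = inner ℂ (y j) (π₁ b (x j)) :=
    fun j b => by
      have h1 : (V : J →L[ℂ] J) (x j) = μ j • x j := Module.End.mem_eigenspace_iff.1 (hxV j)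
      have h2 : (V : J →L[ℂ] J) (y j) = μ j • y j := Module.End.mem_eigenspace_iff.1 (hyV j)
      have h3 := Unitary.inner_map_map V (y j) (π₁ b (x j))
      have hμ : (starRingEnd ℂ) (μ j) * μ j = 1 := by
        rw [mul_comm, Complex.mul_conj, Complex.normSq_eq_norm_sq,
          norm_eq_one_of_mem_eigenspace (hxV j) (hx.ne_zero j)]
        simp
      rw [hd.apply_apply, h1, h2, map_smul, inner_smul_left, inner_smul_right, ← mul_assoc, hμ,
        one_mul] at h3
      exact h3
  let f : ℕ → ℂ := fun s => ∑ j, inner ℂ (y j) (π₁ ((σ ^ s) a) (x j))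
  have hf : ∀ s, f (s + m) = f s := fun s => by
    refine Finset.sum_congr rfl fun j _ => ?_
    rw [add_comm, pow_add]
    exact hper j _
  have h1 := h _ (sum_pow_apply_mem_fixedPointAlgebra hσ a)
  simp only [map_sum, sum_apply, inner_sum] at h1
  rw [Finset.sum_comm] at h1
  change ∑ s ∈ Finset.range (k * m), f s = 0 at h1
  rw [sum_range_mul_of_periodic hf, smul_eq_zero_iff_right hk.ne', Finset.sum_range] at h1
  exact h1

theorem IsCyclicDatum.apply_mem_eigenspace (hd : IsCyclicDatum σ k m π₁ V) (μ : ℂ)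
    (b : fixedPointAlgebra σ) (x : J)
    (hx : x ∈ Module.End.eigenspace ((V : J →L[ℂ] J) : Module.End ℂ J) μ) :
    π₁.comp (fixedPointAlgebra σ).subtype b x ∈
      Module.End.eigenspace ((V : J →L[ℂ] J) : Module.End ℂ J) μ := by
  have h1 : (V : J →L[ℂ] J) x = μ • x := Module.End.mem_eigenspace_iff.1 hx
  refine Module.End.mem_eigenspace_iff.2 ?_
  change (V : J →L[ℂ] J) (π₁ b x) = μ • π₁ b x
  rw [hd.apply_apply, h1, map_smul, pow_apply_of_mem_fixedPointAlgebra b.2]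

/-- The restriction of `π₁` to the fixed-point algebra of `σ`, acting on the eigenspace of `V` for
`μ`. -/
noncomputable def IsCyclicDatum.eigenRep (hd : IsCyclicDatum σ k m π₁ V) (μ : ℂ) :
    fixedPointAlgebra σ →⋆ₐ[ℂ]
      (Module.End.eigenspace ((V : J →L[ℂ] J) : Module.End ℂ J) μ →L[ℂ]
        Module.End.eigenspace ((V : J →L[ℂ] J) : Module.End ℂ J) μ) :=
  subRep (π₁.comp (fixedPointAlgebra σ).subtype) _ (hd.apply_mem_eigenspace μ)

theorem IsCyclicDatum.isIrreducibleRep_eigenRep (hσ : σ ^ (k * m) = 1)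
    (hk : 0 < k) (hm : 0 < m) (hd : IsCyclicDatum σ k m π₁ V) {μ : ℂ}
    (hμ : Module.End.eigenspace ((V : J →L[ℂ] J) : Module.End ℂ J) μ ≠ ⊥) :
    IsIrreducibleRep (hd.eigenRep μ) := by
  refine isIrreducibleRep_subRep_of_orbit _ _ _ hμ fun x hx hx0 y hy hxy => ?_
  have := hd.eq_zero_of_sum_inner_fixedPointAlgebra hσ hk hm (x := fun _ : Unit => x)
    (y := fun _ => y) (μ := fun _ => μ) (LinearIndependent.of_subsingleton () hx0)
    (fun _ => hx) (fun _ => hy) fun b hb => by simpa using hxy ⟨b, hb⟩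
  exact congrFun this ()

/-- If `W` were an equivalence and `x` an eigenvector, `⟪x, b x⟫ - ⟪W x, b W x⟫` would vanish for
all `b` fixed by `σ`, although `x` and `W x` are linearly independent. -/
theorem IsCyclicDatum.not_unitarilyEquivalent_eigenRep (hσ : σ ^ (k * m) = 1)
    (hk : 0 < k) (hm : 0 < m) (hd : IsCyclicDatum σ k m π₁ V) {μ ν : ℂ}
    (hμ : Module.End.eigenspace ((V : J →L[ℂ] J) : Module.End ℂ J) μ ≠ ⊥) (hμν : μ ≠ ν) :
    ¬ UnitarilyEquivalent (hd.eigenRep μ) (hd.eigenRep ν) := by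
  rintro ⟨W, hW⟩
  obtain ⟨x, hx, hx0⟩ := (Submodule.ne_bot_iff _).1 hμ
  obtain ⟨z, hz⟩ : ∃ z, z = W ⟨x, hx⟩ := ⟨_, rfl⟩
  have hz0 : (z : J) ≠ 0 := by
    rw [hz]
    simpa using hx0
  have horth : inner ℂ x (z : J) = 0 :=
    orthogonalFamily_eigenspace_unitary V hμν ⟨x, hx⟩ z
  have hlin : LinearIndependent ℂ ![x, (z : J)] := by
    rw [LinearIndependent.pair_iff]
    intro s t hst
    have h1 := congrArg (inner ℂ x) hst
    have h2 := congrArg (inner ℂ (z : J)) hst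
    rw [inner_add_right, inner_smul_right, inner_smul_right, horth, inner_zero_right, mul_zero,
      add_zero] at h1
    rw [inner_add_right, inner_smul_right, inner_smul_right, inner_eq_zero_symm.1 horth,
      inner_zero_right, mul_zero, zero_add] at h2
    exact ⟨(mul_eq_zero.1 h1).resolve_right (inner_self_ne_zero.2 hx0),
      (mul_eq_zero.1 h2).resolve_right (inner_self_ne_zero.2 hz0)⟩
  have := hd.eq_zero_of_sum_inner_fixedPointAlgebra hσ hk hm (x := ![x, (z : J)])
    (y := ![x, -(z : J)]) (μ := ![μ, ν]) hlin
    (fun j => by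
      fin_cases j
      · exact hx
      · exact z.2)
    (fun j => by
      fin_cases j
      · exact hx
      · exact Submodule.neg_mem _ z.2) fun b hb => by
      have h1 := hW ⟨b, hb⟩ ⟨x, hx⟩
      have h2 := W.inner_map_map ⟨x, hx⟩ (hd.eigenRep μ ⟨b, hb⟩ ⟨x, hx⟩)
      rw [h1, ← hz] at h2
      have h3 : inner ℂ (z : J) (π₁ b z) = inner ℂ x (π₁ b x) := h2
      simp [Fin.sum_univ_two, inner_neg_left, h3]
  exact hx0 (congrFun this 0)

end FixedPoint

universe w

theorem IsCyclicDatum.exists_restriction_fixedPointAlgebra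
    {A : Type*} [CStarAlgebra A] {σ : A ≃⋆ₐ[ℂ] A} {k m : ℕ}
    {J : Type w} [NormedAddCommGroup J] [InnerProductSpace ℂ J] [CompleteSpace J]
    {π₁ : A →⋆ₐ[ℂ] (J →L[ℂ] J)} {V : unitary (J →L[ℂ] J)}
    (hσ : σ ^ (k * m) = 1) [NeZero k] (hm : 0 < m) (hd : IsCyclicDatum σ k m π₁ V) :
    ∃ (η : ℕ) (_ : (spectrum ℂ (V : J →L[ℂ] J)).encard = η)
      (K : Fin η → Type w) (_ : ∀ j, NormedAddCommGroup (K j))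
      (_ : ∀ j, InnerProductSpace ℂ (K j)) (_ : ∀ j, CompleteSpace (K j))
      (φ : ∀ j, fixedPointAlgebra σ →⋆ₐ[ℂ] (K j →L[ℂ] K j)),
      (∀ j, IsIrreducibleRep (φ j)) ∧
      (∀ i j, i ≠ j → ¬ UnitarilyEquivalent (φ i) (φ j)) ∧
      ∀ i : Fin m,
        UnitarilyEquivalent ((twistRep σ π₁ i).comp (fixedPointAlgebra σ).subtype)
          (directSumRep φ) := by
  have hk : 0 < k := NeZero.pos k
  have hfin := finite_spectrum_of_pow_eq_one hd.pow_eq_one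
  have := hfin.fintype
  have hcard : (spectrum ℂ (V : J →L[ℂ] J)).encard =
      (Fintype.card (spectrum ℂ (V : J →L[ℂ] J)) : ℕ) := by
    rw [Set.encard_eq_coe_toFinset_card, Set.toFinset_card]
  let e : Fin (Fintype.card (spectrum ℂ (V : J →L[ℂ] J))) ≃ spectrum ℂ (V : J →L[ℂ] J) :=
    (Fintype.equivFin _).symm
  let E : ℂ → Submodule ℂ J := fun μ =>
    Module.End.eigenspace ((V : J →L[ℂ] J) : Module.End ℂ J) μ
  have hspec : ∀ j, E (e j) ≠ ⊥ := fun j =>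
    (mem_spectrum_iff_eigenspace_ne_bot hd.pow_eq_one _).1 (e j).2
  have horth : OrthogonalFamily ℂ (fun j => E (e j)) fun j => (E (e j)).subtypeₗᵢ :=
    (orthogonalFamily_eigenspace_unitary V).comp (Subtype.val_injective.comp e.injective)
  have htop : ⨆ j, E (e j) = ⊤ := by
    rw [eq_top_iff, ← iSup_eigenspace_eq_top_of_pow_eq_one (toLinearMap_pow_eq_one hd.pow_eq_one)]
    refine iSup_le fun μ => ?_
    by_cases hμ : E μ = ⊥
    · exact hμ.le.trans bot_le
    · have hmem := (mem_spectrum_iff_eigenspace_ne_bot hd.pow_eq_one μ).2 hμ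
      have : E μ = E (e (e.symm ⟨μ, hmem⟩)) := by rw [e.apply_symm_apply]
      exact this.le.trans (le_iSup (fun j => E (e j)) _)
  have hrep : ∀ i : Fin m, (twistRep σ π₁ i).comp (fixedPointAlgebra σ).subtype =
      π₁.comp (fixedPointAlgebra σ).subtype := fun i => by
    ext b x
    change π₁ ((σ ^ (i : ℕ)) b) x = π₁ b x
    rw [pow_apply_of_mem_fixedPointAlgebra b.2]
  have hsum := unitarilyEquivalent_directSumRep_subRep (π₁.comp (fixedPointAlgebra σ).subtype)
    (fun j => E (e j)) (fun j => hd.apply_mem_eigenspace (e j)) horth htop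
  refine ⟨_, hcard, fun j => E (e j), fun _ => inferInstance, fun _ => inferInstance,
    fun _ => inferInstance, fun j => hd.eigenRep (e j),
    fun j => hd.isIrreducibleRep_eigenRep hσ hk hm (hspec j),
    fun i j hij => hd.not_unitarilyEquivalent_eigenRep hσ hk hm (hspec i) fun h =>
      hij (e.injective (Subtype.ext h)), fun i => ?_⟩
  rw [hrep]
  exact hsum

/-! ### The datum of an irreducible representation -/

section Datum

variable {A : Type*} [CStarAlgebra A] {σ : A ≃⋆ₐ[ℂ] A} {k m n : ℕ}
  {J : Type*} [NormedAddCommGroup J] [InnerProductSpace ℂ J] [CompleteSpace J]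
  {π₁ : A →⋆ₐ[ℂ] (J →L[ℂ] J)}

theorem UnitarilyEquivalent.twistRep_mul
    (h : UnitarilyEquivalent π₁ (_root_.twistRep σ π₁ m)) (q : ℕ) :
    UnitarilyEquivalent π₁ (_root_.twistRep σ π₁ (q * m)) := by
  induction q with
  | zero => rw [zero_mul, twistRep_zero]; exact UnitarilyEquivalent.refl _
  | succ q ih =>
    rw [add_mul, one_mul, ← twistRep_twistRep]
    exact h.trans (ih.twistRep m)

/-- The smallest `m > 0` with `π₁ ∘ σᵐ` equivalent to `π₁` divides `n`. -/
theorem exists_period [NeZero n] (hσ : σ ^ n = 1) (π₁ : A →⋆ₐ[ℂ] (J →L[ℂ] J)) :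
    ∃ k m : ℕ, k * m = n ∧ UnitarilyEquivalent π₁ (twistRep σ π₁ m) ∧
      ∀ i, 0 < i → i < m → ¬ UnitarilyEquivalent π₁ (twistRep σ π₁ i) := by
  classical
  have hn : twistRep σ π₁ n = π₁ := by
    ext a x
    rw [twistRep_apply, hσ]
    rfl
  have hex : ∃ m, 0 < m ∧ UnitarilyEquivalent π₁ (twistRep σ π₁ m) :=
    ⟨n, NeZero.pos n, by rw [hn]; exact UnitarilyEquivalent.refl _⟩
  obtain ⟨hm, hE⟩ := Nat.find_spec hex
  have hmin : ∀ i, 0 < i → i < Nat.find hex → ¬ UnitarilyEquivalent π₁ (twistRep σ π₁ i) :=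
    fun i hi hlt hE' => Nat.find_min hex hlt ⟨hi, hE'⟩
  refine ⟨n / Nat.find hex, Nat.find hex, Nat.div_mul_cancel (Nat.dvd_of_mod_eq_zero ?_), hE, hmin⟩
  -- otherwise the remainder of `n` modulo `m` would be a smaller period
  by_contra hr
  refine hmin _ (Nat.pos_of_ne_zero hr) (Nat.mod_lt n hm) ?_
  have h1 := (hE.twistRep_mul (n / Nat.find hex)).twistRep (σ := σ) (n % Nat.find hex)
  rw [twistRep_twistRep, Nat.div_add_mod', hn] at h1
  exact h1.symm

theorem smul_mem_unitary_of_norm_eq_one {d : ℂ} (hd : ‖d‖ = 1) (u : unitary (J →L[ℂ] J)) :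
    d • (u : J →L[ℂ] J) ∈ unitary (J →L[ℂ] J) := by
  have h : star d * d = 1 := by
    rw [mul_comm]
    change d * (starRingEnd ℂ) d = 1
    rw [Complex.mul_conj, Complex.normSq_eq_norm_sq, hd]
    simp
  rw [Unitary.mem_iff, star_smul, smul_mul_smul_comm, smul_mul_smul_comm, mul_comm d, h,
    Unitary.coe_star_mul_self, Unitary.mul_star_self_of_mem u.2, one_smul]
  exact ⟨rfl, rfl⟩

/-- An equivalence of `π₁` with `π₁ ∘ σᵐ` is implemented by a unitary whose `k`-th power is a
scalar by Schur's lemma, and the scalar can be normalized to `1`. -/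
theorem exists_unitary_implementing (hσ : σ ^ (k * m) = 1) (hk : k ≠ 0)
    (hirr : IsIrreducibleRep π₁) (hE : UnitarilyEquivalent π₁ (twistRep σ π₁ m)) :
    ∃ V : unitary (J →L[ℂ] J), V ^ k = 1 ∧
      ∀ a, (V : J →L[ℂ] J) * π₁ a = π₁ ((σ ^ m) a) * V := by
  obtain ⟨W, hW⟩ := hE
  have := hirr.1
  let u : unitary (J →L[ℂ] J) := Unitary.linearIsometryEquiv.symm W
  have hu : ∀ a, (u : J →L[ℂ] J) * π₁ a = π₁ ((σ ^ m) a) * u := fun a =>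
    ContinuousLinearMap.ext fun x => hW a x
  have hupow : ∀ (j : ℕ) (a : A),
      (u : J →L[ℂ] J) ^ j * π₁ a = π₁ ((σ ^ (j * m)) a) * (u : J →L[ℂ] J) ^ j := fun j a => by
    induction j generalizing a with
    | zero => simp
    | succ j ih =>
      rw [pow_succ, mul_assoc, hu, ← mul_assoc, ih, mul_assoc, add_mul, one_mul, pow_add]
      rfl
  obtain ⟨c, hc⟩ := hirr.exists_eq_smul (T := (u : J →L[ℂ] J) ^ k) fun a x => by
    have h := DFunLike.congr_fun (hupow k a) x
    rw [hσ] at h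
    exact h
  have hc1 : ‖c‖ = 1 := by
    obtain ⟨x, hx⟩ := exists_ne (0 : J)
    have h := Unitary.norm_map (u ^ k) x
    rw [SubmonoidClass.coe_pow, hc, norm_smul] at h
    exact mul_right_cancel₀ (norm_ne_zero_iff.2 hx) (by rw [h, one_mul])
  -- dividing by a `k`-th root of `c` normalizes `u ^ k = c` to `1`
  obtain ⟨d, hd⟩ := IsAlgClosed.exists_pow_nat_eq c⁻¹ (Nat.pos_of_ne_zero hk)
  have hd1 : ‖d‖ = 1 := by
    have h := congrArg norm hd
    rw [norm_pow, norm_inv, hc1, inv_one] at h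
    exact (pow_eq_one_iff_of_nonneg (norm_nonneg _) hk).1 h
  have hc0 : c ≠ 0 := fun h => by simp [h] at hc1
  refine ⟨⟨d • (u : J →L[ℂ] J), smul_mem_unitary_of_norm_eq_one hd1 u⟩, Subtype.ext ?_, fun a => ?_⟩
  · ext x
    rw [SubmonoidClass.coe_pow, smul_pow, hd]
    change c⁻¹ • ((u : J →L[ℂ] J) ^ k) x = x
    rw [hc, inv_smul_smul₀ hc0]
  · change d • (u : J →L[ℂ] J) * π₁ a = π₁ ((σ ^ m) a) * d • (u : J →L[ℂ] J)
    rw [smul_mul_assoc, hu, mul_smul_comm]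

variable [NeZero n] {hσ : σ ^ n = 1}
  {H : Type*} [NormedAddCommGroup H] [InnerProductSpace ℂ H] [CompleteSpace H]

theorem map_cyclicUnitary_pow_mul (P : CyclicCrossedProduct σ n hσ →⋆ₐ[ℂ] (H →L[ℂ] H)) (j : ℕ)
    (a : A) :
    P (cyclicUnitary σ n hσ) ^ j * P (cyclicEmbed σ n hσ a) =
      P (cyclicEmbed σ n hσ ((σ ^ j) a)) * P (cyclicUnitary σ n hσ) ^ j := by
  induction j generalizing a with
  | zero => simp
  | succ j ih =>
    rw [pow_succ, mul_assoc, ← map_mul, cyclicUnitary_mul_embed, map_mul, ← mul_assoc, ih,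
      mul_assoc, pow_succ]
    rfl

/-- If `V` implements `σᵐ` in `π₁` and `π₁` occurs in `P`, then `S ↦ Uᵐ S V*` is an endomorphism of
finite order of the space of intertwiners from `π₁` to `P`, and it has an eigenvector. Absorbing
the eigenvalue in `V` gives an intertwiner that also intertwines `V` with `Uᵐ`. -/
theorem exists_intertwiner (hkm : k * m = n)
    (P : CyclicCrossedProduct σ n hσ →⋆ₐ[ℂ] (H →L[ℂ] H))
    {V : unitary (J →L[ℂ] J)} (hVk : V ^ k = 1)
    (hV : ∀ a, (V : J →L[ℂ] J) * π₁ a = π₁ ((σ ^ m) a) * V)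
    {S₀ : J →L[ℂ] H} (hS₀ : ∀ a x, S₀ (π₁ a x) = P (cyclicEmbed σ n hσ a) (S₀ x)) (h0 : S₀ ≠ 0) :
    ∃ (V' : unitary (J →L[ℂ] J)) (S : J →L[ℂ] H), V' ^ k = 1 ∧
      (∀ a, (V' : J →L[ℂ] J) * π₁ a = π₁ ((σ ^ m) a) * V') ∧
      (∀ a x, S (π₁ a x) = P (cyclicEmbed σ n hσ a) (S x)) ∧
      (∀ x, (P (cyclicUnitary σ n hσ) ^ m) (S x) = S ((V' : J →L[ℂ] J) x)) ∧ S ≠ 0 := by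
  have hk : NeZero k := ⟨fun hk => NeZero.ne n (by rw [← hkm, hk, zero_mul])⟩
  obtain ⟨u, hu⟩ : ∃ u : H →L[ℂ] H, u = P (cyclicUnitary σ n hσ) := ⟨_, rfl⟩
  have hum : ∀ a x, (u ^ m) (P (cyclicEmbed σ n hσ a) x) =
      P (cyclicEmbed σ n hσ ((σ ^ m) a)) ((u ^ m) x) := fun a x => by
    rw [hu]
    exact DFunLike.congr_fun (map_cyclicUnitary_pow_mul P m a) x
  have hun : u ^ n = 1 := by
    rw [hu, ← map_pow, ← SubmonoidClass.coe_pow, cyclicUnitary_pow, OneMemClass.coe_one, map_one]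
  have hVs : ∀ a x, (star V : J →L[ℂ] J) (π₁ ((σ ^ m) a) x) = π₁ a ((star V : J →L[ℂ] J) x) := by
    intro a x
    have h : (star V : J →L[ℂ] J) * π₁ ((σ ^ m) a) = π₁ a * (star V : J →L[ℂ] J) := by
      calc (star V : J →L[ℂ] J) * π₁ ((σ ^ m) a)
          = star (V : J →L[ℂ] J) * (π₁ ((σ ^ m) a) * V) * star (V : J →L[ℂ] J) := by
            rw [mul_assoc, mul_assoc, Unitary.mul_star_self_of_mem V.2, mul_one]
        _ = π₁ a * star (V : J →L[ℂ] J) := by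
            rw [← hV, ← mul_assoc, Unitary.coe_star_mul_self, one_mul]
    exact DFunLike.congr_fun h x
  let I : Submodule ℂ (J →L[ℂ] H) :=
    { carrier := {S | ∀ a x, S (π₁ a x) = P (cyclicEmbed σ n hσ a) (S x)}
      add_mem' := fun {S T} hS hT a x => by simp [hS a x, hT a x]
      zero_mem' := fun a x => by simp
      smul_mem' := fun c S hS a x => by simp [hS a x] }
  let Θ : Module.End ℂ I :=
    { toFun := fun S => ⟨(u ^ m) ∘L S.1 ∘L (star V : J →L[ℂ] J), fun a x => by
        have hS := S.2
        obtain ⟨a, rfl⟩ := EquivLike.surjective (σ ^ m) a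
        simp only [ContinuousLinearMap.comp_apply]
        rw [hVs, hS, hum]⟩
      map_add' := fun S T => by ext; simp
      map_smul' := fun c S => by ext; simp }
  have hΘ : ∀ (S : I) x, (Θ S).1 x = (u ^ m) (S.1 ((star V : J →L[ℂ] J) x)) := fun _ _ => rfl
  have hΘpow : ∀ (j : ℕ) (S : I) x,
      ((Θ ^ j) S).1 x = (u ^ (j * m)) (S.1 (((star V : J →L[ℂ] J) ^ j) x)) := fun j => by
    induction j with
    | zero => simp
    | succ j ih =>
      intro S x
      rw [pow_succ', Module.End.mul_apply, hΘ, ih, add_mul, one_mul, add_comm, pow_add,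
        mul_apply_eq_comp, pow_succ, mul_apply_eq_comp]
  have hΘk : Θ ^ k = 1 := by
    refine LinearMap.ext fun S => Subtype.ext (ContinuousLinearMap.ext fun x => ?_)
    have hs : (star V : J →L[ℂ] J) ^ k = 1 := by
      rw [← Unitary.coe_star, ← SubmonoidClass.coe_pow, ← star_pow, hVk, star_one]
      rfl
    rw [hΘpow, hkm, hun, hs]
    rfl
  have hnt : Nontrivial I := ⟨⟨S₀, hS₀⟩, 0, fun h => h0 (congrArg Subtype.val h)⟩
  obtain ⟨μ, hμ⟩ : ∃ μ, Θ.eigenspace μ ≠ ⊥ := by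
    by_contra! hbot
    have h := iSup_eigenspace_eq_top_of_pow_eq_one hΘk
    simp only [hbot, iSup_bot] at h
    exact bot_ne_top h
  obtain ⟨S, hS, hS0⟩ := (Submodule.ne_bot_iff _).1 hμ
  have hμk := pow_eq_one_of_mem_eigenspace hΘk hS hS0
  have hμ1 : ‖μ‖ = 1 := Complex.norm_eq_one_of_pow_eq_one hμk (NeZero.ne k)
  refine ⟨⟨μ • (V : J →L[ℂ] J), smul_mem_unitary_of_norm_eq_one hμ1 V⟩, S.1, Subtype.ext ?_,
    fun a => ?_, S.2, fun x => ?_, fun h => hS0 (Subtype.ext h)⟩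
  · rw [SubmonoidClass.coe_pow, smul_pow, hμk, one_smul, ← SubmonoidClass.coe_pow, hVk]
  · change μ • (V : J →L[ℂ] J) * π₁ a = π₁ ((σ ^ m) a) * μ • (V : J →L[ℂ] J)
    rw [smul_mul_assoc, hV, mul_smul_comm]
  · have h1 := hΘ S ((V : J →L[ℂ] J) x)
    rw [Module.End.mem_eigenspace_iff.1 hS] at h1
    have h2 : (star V : J →L[ℂ] J) ((V : J →L[ℂ] J) x) = x :=
      DFunLike.congr_fun (Unitary.coe_star_mul_self V) x
    rw [h2] at h1
    rw [← hu, ← h1]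
    exact (S.1.map_smul μ _).symm

/-- The operator `ξ ↦ ∑ᵢ U⁻ⁱ S ξᵢ` intertwines the representation of cyclic form with `P`. -/
theorem exists_intertwiner_of_isCyclicForm (hm : 0 < m)
    {P : CyclicCrossedProduct σ n hσ →⋆ₐ[ℂ] (H →L[ℂ] H)} {V : unitary (J →L[ℂ] J)}
    {S : J →L[ℂ] H} (hS : ∀ a x, S (π₁ a x) = P (cyclicEmbed σ n hσ a) (S x))
    (hSV : ∀ x, (P (cyclicUnitary σ n hσ) ^ m) (S x) = S ((V : J →L[ℂ] J) x)) (hS0 : S ≠ 0)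
    {Q : CyclicCrossedProduct σ n hσ →⋆ₐ[ℂ]
      (PiLp 2 (fun _ : Fin m => J) →L[ℂ] PiLp 2 (fun _ : Fin m => J))}
    (hQ : IsCyclicForm σ n hσ m π₁ V Q) :
    ∃ T : PiLp 2 (fun _ : Fin m => J) →L[ℂ] H, (∀ b ξ, T (Q b ξ) = P b (T ξ)) ∧ T ≠ 0 := by
  obtain ⟨u, hu⟩ : ∃ u : H →L[ℂ] H, u = P (cyclicUnitary σ n hσ) := ⟨_, rfl⟩
  obtain ⟨w, hw⟩ : ∃ w : H →L[ℂ] H, w = star u := ⟨_, rfl⟩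
  have hwu : w * u = 1 := by
    rw [hw, hu, ← map_star, ← map_mul, Unitary.coe_star_mul_self, map_one]
  have huw : u * w = 1 := by
    rw [hw, hu, ← map_star, ← map_mul, Unitary.mul_star_self_of_mem (cyclicUnitary σ n hσ).2,
      map_one]
  have hcomm : Commute w u := hwu.trans huw.symm
  have hwuj : ∀ j, w ^ j * u ^ j = 1 := fun j => by rw [← hcomm.mul_pow, hwu, one_pow]
  have huwj : ∀ j, u ^ j * w ^ j = 1 := fun j => by rw [← hcomm.symm.mul_pow, huw, one_pow]
  have hwa : ∀ (j : ℕ) a x, (w ^ j) (P (cyclicEmbed σ n hσ ((σ ^ j) a)) x) =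
      P (cyclicEmbed σ n hσ a) ((w ^ j) x) := fun j a x => by
    have h := map_cyclicUnitary_pow_mul P j a
    rw [← hu] at h
    have h' : w ^ j * P (cyclicEmbed σ n hσ ((σ ^ j) a)) = P (cyclicEmbed σ n hσ a) * w ^ j := by
      calc w ^ j * P (cyclicEmbed σ n hσ ((σ ^ j) a))
          = w ^ j * (P (cyclicEmbed σ n hσ ((σ ^ j) a)) * u ^ j) * w ^ j := by
            rw [mul_assoc, mul_assoc, huwj, mul_one]
        _ = P (cyclicEmbed σ n hσ a) * w ^ j := by rw [← h, ← mul_assoc, hwuj, one_mul]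
    exact DFunLike.congr_fun h' x
  let T : PiLp 2 (fun _ : Fin m => J) →L[ℂ] H :=
    ∑ i : Fin m, (w ^ (i : ℕ)) ∘L S ∘L PiLp.proj 2 (fun _ : Fin m => J) i
  have hT : ∀ ξ, T ξ = ∑ i : Fin m, (w ^ (i : ℕ)) (S (ξ i)) := fun ξ => by
    simp only [T, sum_apply]
    rfl
  refine ⟨T, cyclic_intertwines_of_generators (fun a ξ => ?_) fun ξ => ?_, fun h0 => hS0 ?_⟩
  · rw [hQ.1, hT, hT, map_sum]
    refine Finset.sum_congr rfl fun i _ => ?_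
    change (w ^ (i : ℕ)) (S (π₁ ((σ ^ (i : ℕ)) a) (ξ i))) = _
    rw [hS, hwa]
  · rw [hQ.2, hT, hT, map_sum, ← hu]
    obtain ⟨m, rfl⟩ : ∃ l, m = l + 1 := ⟨m - 1, by omega⟩
    rw [Fin.sum_univ_castSucc, Fin.sum_univ_succ, add_comm]
    congr 1
    · rw [cyclicShift_apply, dif_neg (by simp), ← hSV, ← hu, pow_succ, mul_apply_eq_comp,
        ← mul_apply_eq_comp (w ^ _), Fin.val_last, hwuj]
      simp
    · refine Finset.sum_congr rfl fun i _ => ?_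
      rw [cyclicShift_apply, dif_pos (by simp), ← mul_apply_eq_comp u, Fin.val_succ, pow_succ',
        ← mul_assoc, huw, one_mul]
      rfl
  · ext x
    have h := hT (WithLp.toLp 2 (Pi.single (⟨0, hm⟩ : Fin m) x))
    rw [h0, Finset.sum_eq_single (⟨0, hm⟩ : Fin m)
      (fun i _ hi => by simp [Pi.single_eq_of_ne hi]) fun hi => absurd (Finset.mem_univ _) hi] at h
    simpa using h.symm

end Datum

/-! ### Irreducible representations of `A ⋊_σ ℤ/n` -/

theorem mainTheorem2 {A : Type u} [CStarAlgebra A] (n : ℕ) [NeZero n]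
    (σ : A ≃⋆ₐ[ℂ] A) (hσ : σ ^ n = 1) :
    -- a representation is irreducible iff it has the cyclic form, up to unitary equivalence
    (∀ (H : Type v) [NormedAddCommGroup H] [InnerProductSpace ℂ H] [CompleteSpace H]
        (P : CyclicCrossedProduct σ n hσ →⋆ₐ[ℂ] (H →L[ℂ] H)),
      IsIrreducibleRep P ↔
        ∃ (k m : ℕ) (_ : k * m = n)
          (J : Type v) (_ : NormedAddCommGroup J) (_ : InnerProductSpace ℂ J)
          (_ : CompleteSpace J)
          (π₁ : A →⋆ₐ[ℂ] (J →L[ℂ] J)) (V : unitary (J →L[ℂ] J))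
          (Q : CyclicCrossedProduct σ n hσ →⋆ₐ[ℂ]
            (PiLp 2 (fun _ : Fin m => J) →L[ℂ] PiLp 2 (fun _ : Fin m => J))),
          IsCyclicDatum σ k m π₁ V ∧ IsCyclicForm σ n hσ m π₁ V Q ∧
            UnitarilyEquivalent P Q) ∧
    -- what holds for every choice of the data
    (∀ (k m : ℕ) [NeZero k] (hkm : k * m = n)
        (J : Type v) [NormedAddCommGroup J] [InnerProductSpace ℂ J] [CompleteSpace J]
        (π₁ : A →⋆ₐ[ℂ] (J →L[ℂ] J)) (V : unitary (J →L[ℂ] J)),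
      IsCyclicDatum σ k m π₁ V →
        -- the formulas define a unique representation, which is irreducible
        (∃! Q : CyclicCrossedProduct σ n hσ →⋆ₐ[ℂ]
            (PiLp 2 (fun _ : Fin m => J) →L[ℂ] PiLp 2 (fun _ : Fin m => J)),
          IsCyclicForm σ n hσ m π₁ V Q) ∧
        (∀ Q : CyclicCrossedProduct σ n hσ →⋆ₐ[ℂ]
            (PiLp 2 (fun _ : Fin m => J) →L[ℂ] PiLp 2 (fun _ : Fin m => J)),
          IsCyclicForm σ n hσ m π₁ V Q → IsIrreducibleRep Q) ∧
        -- `π₁` and `V` define a minimal representation of the crossed product by `σ ^ m`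
        (∃! ψ : CyclicCrossedProduct (σ ^ m) k (pow_pow_eq_one_of_mul_eq hkm hσ) →⋆ₐ[ℂ]
            (J →L[ℂ] J),
          (∀ a : A, ψ (cyclicEmbed (σ ^ m) k (pow_pow_eq_one_of_mul_eq hkm hσ) a) = π₁ a) ∧
            ψ (cyclicUnitary (σ ^ m) k (pow_pow_eq_one_of_mul_eq hkm hσ)) = V) ∧
        (∀ ψ : CyclicCrossedProduct (σ ^ m) k (pow_pow_eq_one_of_mul_eq hkm hσ) →⋆ₐ[ℂ]
            (J →L[ℂ] J),
          (∀ a : A, ψ (cyclicEmbed (σ ^ m) k (pow_pow_eq_one_of_mul_eq hkm hσ) a) = π₁ a) →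
            ψ (cyclicUnitary (σ ^ m) k (pow_pow_eq_one_of_mul_eq hkm hσ)) = V →
              IsMinimalRep ψ) ∧
        -- the restrictions to the fixed-point algebra of `σ`
        ∃ (η : ℕ) (_ : (spectrum ℂ (V : J →L[ℂ] J)).encard = η)
          (K : Fin η → Type v) (_ : ∀ j, NormedAddCommGroup (K j))
          (_ : ∀ j, InnerProductSpace ℂ (K j)) (_ : ∀ j, CompleteSpace (K j))
          (φ : ∀ j, fixedPointAlgebra σ →⋆ₐ[ℂ] (K j →L[ℂ] K j)),
          (∀ j, IsIrreducibleRep (φ j)) ∧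
          (∀ i j, i ≠ j → ¬ UnitarilyEquivalent (φ i) (φ j)) ∧
          ∀ i : Fin m,
            UnitarilyEquivalent ((twistRep σ π₁ i).comp (fixedPointAlgebra σ).subtype)
              (directSumRep φ)) := by
  have hpos : ∀ {k m : ℕ}, k * m = n → k ≠ 0 ∧ 0 < m := fun hkm =>
    have h := mul_ne_zero_iff.1 (hkm ▸ NeZero.ne n)
    ⟨h.1, Nat.pos_of_ne_zero h.2⟩
  refine ⟨fun H _ _ _ P => ⟨fun hP => ?_, ?_⟩, fun k m _ hkm J _ _ _ π₁ V hd =>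
    ⟨hd.existsUnique_isCyclicForm hkm, fun Q hQ => hd.isIrreducibleRep_of_isCyclicForm hkm hQ,
      hd.existsUnique_minimal, fun ψ hψ _ => isMinimalRep_of_comp_embed ?_,
      hd.exists_restriction_fixedPointAlgebra (hkm ▸ hσ) (hpos hkm).2⟩⟩
  · obtain ⟨K, hKc, hK, hirr⟩ := CrossedProduct.exists_isIrreducibleRep_subRep hP
    obtain ⟨k, m, hkm, hE, hmin⟩ := exists_period hσ (subRep _ K hK)
    obtain ⟨hk, hm⟩ := hpos hkm
    obtain ⟨V₀, hV₀k, hV₀⟩ := exists_unitary_implementing (k := k) (hkm ▸ hσ) hk hirr hE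
    have := hirr.1
    have hincl : K.subtypeL ≠ 0 := fun h => by
      obtain ⟨x, hx⟩ := exists_ne (0 : K)
      exact hx (Subtype.ext (DFunLike.congr_fun h x))
    obtain ⟨V, S, hVk, hV, hS, hSV, hS0⟩ :=
      exists_intertwiner hkm P hV₀k hV₀ (S₀ := K.subtypeL) (fun _ _ => rfl) hincl
    have hd : IsCyclicDatum σ k m (subRep _ K hK) V :=
      { irreducible := hirr
        pow_eq_one := hVk
        implements := fun a => by
          rw [hV, mul_assoc, Unitary.mul_star_self_of_mem V.2, mul_one, twistRep_apply]
        inequivalent := hmin }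
    obtain ⟨Q, hQ, -⟩ := hd.existsUnique_isCyclicForm (hσ := hσ) hkm
    obtain ⟨T, hT, hT0⟩ := exists_intertwiner_of_isCyclicForm hm hS hSV hS0 hQ
    exact ⟨k, m, hkm, K, inferInstance, inferInstance, hKc, subRep _ K hK, V, Q, hd, hQ,
      ((hd.isIrreducibleRep_of_isCyclicForm hkm hQ).unitarilyEquivalent_of_intertwiner
        hP hT hT0).symm⟩
  · rintro ⟨k, m, hkm, J, _, _, _, π₁, V, Q, hd, hQ, hPQ⟩
    exact hPQ.symm.isIrreducibleRep (hd.isIrreducibleRep_of_isCyclicForm hkm hQ)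
  · have : ψ.comp (CrossedProduct.embed _) = π₁ := StarAlgHom.ext hψ
    rw [this]
    exact hd.irreducible
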